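/- Let $(k,l)$ be a pair of type $\mathcal{PC}$: $k,l\in L_{1,loc}([0,\infty))$, $k$ is nonnegative and nonincreasing on $(0,\infty)$, and $(k*l)(t)=\int_0^t k(t-\tau)l(\tau)\,d\tau=1$ in $(0,\infty)$. Put $\varphi(\lambda)=\lambda\int_0^\infty e^{-\lambda t}k(t)\,dt$ for $\lambda>0$. For $\tau\ge 0$ let $w(\cdot,\tau):[0,\infty)\to\mathbb R$ be the unique nondecreasing function, left-continuous and with $w(0,\tau)=0$, such that $$\int_0^\infty e^{-\lambda\sigma}w(\sigma,\tau)\,d\sigma=\frac{e^{-\tau\varphi(\lambda)}}{\lambda},\qquad \lambda>0 .$$ For $t>0$ the function $w(t,\cdot)$ is nonincreasing and right-continuous on $[0,\infty)$. Let $$Z(t,x)=-\int_0^\infty H(\tau,x)\,d_\tau w(t,\tau),\qquad H(\tau,x)=(4\pi\tau)^{-d/2}e^{-|x|^2/(4\tau)},\qquad t>0,\ x\in\mathbb R^d,$$ be the fundamental solution of the subdiffusion equation $\partial_t(k*[u-u_0])-\Delta u=0$ on $(0,\infty)\times\mathbb R^d$. Let $d\ge 1$ be an integer with $d\ne 4$,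 let $u_0\in L_1(\mathbb R^d)\cap L_2(\mathbb R^d)$ (real- or complex-valued), and let $u(t,x)=(Z(t,\cdot)\star u_0)(x)=\int_{\mathbb R^d}Z(t,x-y)u_0(y)\,dy$. Then for every $t>0$ this integral converges absolutely for almost every $x$, $u(t,\cdot)\in L_2(\mathbb R^d)$, and $(1*l)(t)=\int_0^t l(\tau)\,d\tau>0$; moreover there is a constant $C>0$, independent of $t$, such that $$\|u(t,\cdot)\|_{L_2(\mathbb R^d)}\le C\,\big[(1*l)(t)\big]^{-\min\{1,\,d/4\}}\qquad\text{for all } t>0 .$$ -/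

import Mathlib

namespace Subdiffusion

open MeasureTheory Set

noncomputable section

/-- Convolution on the positive half-line, `(f ∗ g)(t) = ∫₀ᵗ f(t - τ) g(τ) dτ`. -/
def timeConv (f g : ℝ → ℝ) (t : ℝ) : ℝ :=
  ∫ τ in (0 : ℝ)..t, f (t - τ) * g τ

/-- `(k, l) ∈ PC`: `k` and `l` are locally integrable on `[0, ∞)`, `k` is nonnegative and
nonincreasing on `(0, ∞)`, and `k ∗ l = 1` (almost everywhere) in `(0, ∞)`. -/
structure IsPC (k l : ℝ → ℝ) : Prop where
  locInt_k : LocallyIntegrableOn k (Ici 0)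
  nonneg_k : ∀ t, 0 < t → 0 ≤ k t
  anti_k : AntitoneOn k (Ioi 0)
  locInt_l : LocallyIntegrableOn l (Ici 0)
  conv_eq_one : ∀ᵐ t ∂(volume.restrict (Ioi (0 : ℝ))), timeConv k l t = 1

/-- The Laplace transform `f̂(lam) = ∫₀^∞ e^{-lam t} f(t) dt`. -/
def laplace (f : ℝ → ℝ) (lam : ℝ) : ℝ :=
  ∫ t in Ioi (0 : ℝ), Real.exp (-(lam * t)) * f t

/-- `v = w(·, τ)` : the nondecreasing function on `[0, ∞)`, normalized by `v 0 = 0` and by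
left-continuity, whose Laplace transform is `exp(-τ φ(lam)) / lam` for `lam > 0`, where
`φ(lam) = lam k̂(lam)`. (The right-hand side being nonzero, the Laplace integral of `v` converges;
`v` is then bounded by `1`.) -/
structure IsPropagation (k : ℝ → ℝ) (τ : ℝ) (v : ℝ → ℝ) : Prop where
  mono : MonotoneOn v (Ici 0)
  zero : v 0 = 0
  left_cont : ∀ σ, 0 < σ → ContinuousWithinAt v (Iic σ) σ
  laplace_eq : ∀ lam, 0 < lam →
    laplace v lam = Real.exp (-(τ * (lam * laplace k lam))) / lam

/-- The propagation function `w(t, τ)`, for `t, τ ≥ 0`: `w(·, τ)` is the function described by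
`IsPropagation k τ` (for a kernel `k` of type PC, it exists by Bernstein's theorem and its values
on `[0, ∞)` are unique). -/
def propagation (k : ℝ → ℝ) (t τ : ℝ) : ℝ :=
  Classical.epsilon (IsPropagation k τ) t

open Classical in
/-- The Lebesgue-Stieltjes measure `df` of a nondecreasing function `f` on the line. -/
def stieltjesMeasure (f : ℝ → ℝ) : Measure ℝ :=
  if h : Monotone f then h.stieltjesFunction.measure else 0

/-- The measure `-d_τ w(t, τ)` on `[0, ∞)`. The function `τ ↦ w(t, τ)` is nonincreasing and
right-continuous on `[0, ∞)`; it is extended to `(-∞, 0)` by the constant `w(t, 0)`, so that no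
mass is added. -/
def mixingMeasure (k : ℝ → ℝ) (t : ℝ) : Measure ℝ :=
  stieltjesMeasure fun τ => -propagation k t (max τ 0)

/-- The Gaussian heat kernel `H(τ, x) = (4πτ)^{-d/2} exp(-|x|² / (4τ))`. -/
def heatKernel {d : ℕ} (τ : ℝ) (x : EuclideanSpace ℝ (Fin d)) : ℝ :=
  (4 * Real.pi * τ) ^ (-((d : ℝ) / 2)) * Real.exp (-(‖x‖ ^ 2 / (4 * τ)))

/-- The fundamental solution `Z(t, x) = -∫₀^∞ H(τ, x) d_τ w(t, τ)` of
`∂_t (k ∗ [u - u₀]) - Δu = 0`, subordinated to the heat kernel. -/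
def fundSol {d : ℕ} (k : ℝ → ℝ) (t : ℝ) (x : EuclideanSpace ℝ (Fin d)) : ℝ :=
  ∫ τ in Ioi (0 : ℝ), heatKernel τ x ∂(mixingMeasure k t)

/-- `u(t, x) = (Z(t) ⋆ u₀)(x) = ∫ Z(t, x - y) u₀(y) dy`. -/
def solution {d : ℕ} {𝕜 : Type*} [RCLike 𝕜] (k : ℝ → ℝ)
    (u₀ : EuclideanSpace ℝ (Fin d) → 𝕜) (t : ℝ) (x : EuclideanSpace ℝ (Fin d)) : 𝕜 :=
  ∫ y, fundSol k t (x - y) • u₀ y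

end

end Subdiffusion

namespace Subdiffusion

open MeasureTheory Set Filter Topology
open scoped ENNReal Polynomial

/-! For fixed $t$ the solution is a mixture of heat flows, $u(t)=\int H(\tau)\star
u_0\,d\mu_t(\tau)$, where $\mu_t=-d_\tau w(t,\tau)$ is the law of an inverse subordinator.
Minkowski's inequality and the two Young bounds $\|H(\tau)\star
u_0\|_2\le\min(\|u_0\|_2,(8\pi\tau)^{-d/4}\|u_0\|_1)$ (`lintegral_sq_mixture_le`) reduce everything
to how much mass $\mu_t$ puts near $0$. The claim needed is $\mu_t((0,\delta])\le\min(1,\delta/m)$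
with $m=(1*l)(t)$.

Probability supplies it. The function $w(t,\tau)$ equals $P_\tau([0,t))$, where $(P_\tau)$ is the
convolution semigroup on $[0,\infty)$ with Laplace exponent $\varphi$. Two nonnegative numbers with
sum below $t$ are both below $t$, so $w(t,a+b)\le w(t,a)w(t,b)$ (`IsPC.subordinator_Iio_add_le`).
Integrating in $\tau$ and splitting at $\delta$ gives $M\le\delta+w(t,\delta)M$ for
$M(t)=\int_0^\infty w(t,\tau)\,d\tau$, i.e. $1-w(t,\delta)\le\delta/M$ (`IsPC.inverseMoment_le`).
Finally $M=1*l$: the Laplace transform of $M$ is $1/(\lambda\varphi(\lambda))$, so $k*M=1*1$, and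
convolving with $l$ removes $k$ (`IsPC.lintegral_l`).

The layer-cake formula turns the mass bound into $\int\tau^{-d/4}\,d\mu_t\lesssim m^{-d/4}$ when
$d<4$. When $d>4$ this moment may diverge at $0$; there the $L_2$ bound is used on $(0,1]$ and the
rate saturates at $m^{-1}$. For $d=4$ the same computation produces a logarithm.

The semigroup is constructed directly: a compound Poisson law when $k$ is bounded, then a monotone
limit over truncations of $k$. -/

/-! ### Laplace transforms of measures on the half-line -/

/-- The Laplace transform of a measure on the line. -/
noncomputable def laplaceM (μ : Measure ℝ) (lam : ℝ) : ℝ≥0∞ :=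
  ∫⁻ x, ENNReal.ofReal (Real.exp (-(lam * x))) ∂μ

/-- Uniqueness in the Hausdorff moment problem: integration against a finite measure is continuous
in the sup norm, and polynomials are dense by Weierstrass. -/
theorem unitInterval_measure_ext {ρ ρ' : Measure unitInterval} [IsFiniteMeasure ρ]
    [IsFiniteMeasure ρ'] (h : ∀ n : ℕ, ∫ x, (x : ℝ) ^ n ∂ρ = ∫ x, (x : ℝ) ^ n ∂ρ') : ρ = ρ' := by
  have hint : ∀ (η : Measure unitInterval) [IsFiniteMeasure η] (f : C(unitInterval, ℝ)),
      Integrable f η := fun η _ f => by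
    simpa using f.continuous.integrable_of_hasCompactSupport (HasCompactSupport.of_compactSpace _)
  have hpoly : ∀ p : ℝ[X], ∫ x, p.eval (x : ℝ) ∂ρ = ∫ x, p.eval (x : ℝ) ∂ρ' := by
    intro p
    simp_rw [Polynomial.eval_eq_sum_range]
    have hi : ∀ (η : Measure unitInterval) [IsFiniteMeasure η] (i : ℕ),
        Integrable (fun x : unitInterval => p.coeff i * (x : ℝ) ^ i) η := fun η _ i =>
      hint η ⟨fun x : unitInterval => p.coeff i * (x : ℝ) ^ i, by fun_prop⟩
    rw [integral_finsetSum _ fun i _ => hi ρ i, integral_finsetSum _ fun i _ => hi ρ' i]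
    simp_rw [integral_const_mul, h]
  have hcont : ∀ (η : Measure unitInterval) [IsFiniteMeasure η],
      Continuous fun f : C(unitInterval, ℝ) => ∫ x, f x ∂η := by
    intro η _
    refine continuous_iff_continuousAt.2 fun f => ?_
    have : LipschitzWith (η.real univ).toNNReal fun f : C(unitInterval, ℝ) => ∫ x, f x ∂η := by
      refine LipschitzWith.of_dist_le_mul fun f g => ?_
      rw [Real.dist_eq, ← integral_sub (hint η f) (hint η g), Real.coe_toNNReal _ (by positivity),
        mul_comm]
      exact norm_integral_le_of_norm_le_const (μ := η) (f := fun x => f x - g x)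
        (ae_of_all _ fun x => ContinuousMap.dist_apply_le_dist (f := f) (g := g) x)
    exact this.continuous.continuousAt
  refine ext_of_forall_integral_eq_of_IsFiniteMeasure fun f => ?_
  have hcl : IsClosed {g : C(unitInterval, ℝ) | ∫ x, g x ∂ρ = ∫ x, g x ∂ρ'} :=
    isClosed_eq (hcont ρ) (hcont ρ')
  have hsub : ((polynomialFunctions unitInterval : Subalgebra ℝ C(unitInterval, ℝ)) : Set _) ⊆
      {g : C(unitInterval, ℝ) | ∫ x, g x ∂ρ = ∫ x, g x ∂ρ'} := by
    rw [polynomialFunctions_coe]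
    rintro _ ⟨p, rfl⟩
    exact hpoly p
  have hmem : (f.toContinuousMap : C(unitInterval, ℝ)) ∈
      (polynomialFunctions unitInterval).topologicalClosure := by
    rw [polynomialFunctions_closure_eq_top']; trivial
  exact closure_minimal hsub hcl hmem

/-- A measure on `[0, ∞)` is determined by its Laplace transform. -/
theorem laplaceM_ext {μ ν : Measure ℝ} (hμ : μ (Iio 0) = 0) (hν : ν (Iio 0) = 0)
    (hfin : laplaceM μ 1 ≠ ∞) (h : ∀ lam, 0 < lam → laplaceM μ lam = laplaceM ν lam) : μ = ν := by
  -- The substitution $y=e^{-x}$ reduces the claim to moments on $[0,1]$. Tilting by $e^{-x}$ first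
  -- makes the measure finite, and the $n$-th moment becomes the Laplace transform at $n+1$; both
  -- operations can be undone. The `max` only makes the map total.
  set ψ : ℝ → unitInterval := fun x => ⟨Real.exp (-(max x 0)), (Real.exp_pos _).le,
    Real.exp_le_one_iff.2 (by simp)⟩ with hψ
  have hψm : Measurable ψ := by
    refine Measurable.subtype_mk ?_
    fun_prop
  have hem : Measurable fun x : ℝ => ENNReal.ofReal (Real.exp (-x)) := by fun_prop
  have key : ∀ η : Measure ℝ, η (Iio 0) = 0 → laplaceM η 1 ≠ ∞ →
      IsFiniteMeasure (η.withDensity fun x => ENNReal.ofReal (Real.exp (-x))) ∧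
      (∀ n : ℕ, ∫ x, (x : ℝ) ^ n
        ∂((η.withDensity fun x => ENNReal.ofReal (Real.exp (-x))).map ψ) =
          (laplaceM η (n + 1)).toReal) ∧
      η = (((η.withDensity fun x => ENNReal.ofReal (Real.exp (-x))).map ψ).map
        fun y : unitInterval => -Real.log y).withDensity fun x => ENNReal.ofReal (Real.exp x) := by
    intro η hη hf
    have hnn : ∀ᵐ x ∂η, 0 ≤ x := by
      rw [ae_iff]; simpa [← Iio_def] using hη
    have hnn' : ∀ᵐ x ∂(η.withDensity fun x => ENNReal.ofReal (Real.exp (-x))), 0 ≤ x :=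
      (withDensity_absolutelyContinuous _ _).ae_le hnn
    refine ⟨isFiniteMeasure_withDensity (by simpa [laplaceM] using hf), fun n => ?_, ?_⟩
    · rw [integral_map hψm.aemeasurable (by fun_prop),
        integral_eq_lintegral_of_nonneg_ae (ae_of_all _ fun x => by simp [hψ]; positivity)
          (by fun_prop)]
      congr 1
      rw [lintegral_withDensity_eq_lintegral_mul _ hem (by fun_prop)]
      refine lintegral_congr_ae (hnn.mono fun x hx => ?_)
      simp only [hψ, Pi.mul_apply, max_eq_left hx]
      rw [← ENNReal.ofReal_mul (Real.exp_pos _).le, ← Real.exp_nat_mul, ← Real.exp_add]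
      congr 2; ring
    · rw [Measure.map_map (by fun_prop) hψm]
      have : Measure.map ((fun y : unitInterval => -Real.log y) ∘ ψ)
          (η.withDensity fun x => ENNReal.ofReal (Real.exp (-x))) =
          (η.withDensity fun x => ENNReal.ofReal (Real.exp (-x))) := by
        conv_rhs => rw [← Measure.map_id (μ := η.withDensity _)]
        refine Measure.map_congr (hnn'.mono fun x hx => ?_)
        simp [hψ, max_eq_left hx]
      rw [this, ← withDensity_mul _ hem (by fun_prop)]
      conv_lhs => rw [← withDensity_one (μ := η)]
      congr 1
      ext x
      simp only [Pi.one_apply, Pi.mul_apply]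
      rw [← ENNReal.ofReal_mul (Real.exp_pos _).le, ← Real.exp_add]
      simp
  obtain ⟨f1, m1, e1⟩ := key μ hμ hfin
  obtain ⟨f2, m2, e2⟩ := key ν hν (h 1 one_pos ▸ hfin)
  rw [e1, e2]
  have : (μ.withDensity fun x => ENNReal.ofReal (Real.exp (-x))).map ψ =
      (ν.withDensity fun x => ENNReal.ofReal (Real.exp (-x))).map ψ :=
    unitInterval_measure_ext fun n => by rw [m1, m2, h _ (by positivity)]
  rw [this]

theorem laplaceM_conv (μ ν : Measure ℝ) [SFinite μ] [SFinite ν] (lam : ℝ) :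
    laplaceM (μ.conv ν) lam = laplaceM μ lam * laplaceM ν lam := by
  simp only [laplaceM]
  rw [Measure.lintegral_conv (by fun_prop), ← lintegral_mul_const _ (by fun_prop)]
  refine lintegral_congr fun x => ?_
  rw [← lintegral_const_mul _ (by fun_prop)]
  refine lintegral_congr fun y => ?_
  rw [← ENNReal.ofReal_mul (Real.exp_pos _).le, ← Real.exp_add]
  congr 2; ring

theorem lintegral_exp_Ioi {lam : ℝ} (hl : 0 < lam) (a : ℝ) :
    ∫⁻ s in Ioi a, ENNReal.ofReal (Real.exp (-(lam * s))) =
      ENNReal.ofReal (Real.exp (-(lam * a)) / lam) := by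
  have h := integral_exp_mul_Ioi (a := -lam) (by linarith) a
  simp only [neg_mul] at h
  rw [← ofReal_integral_eq_lintegral_ofReal _ (ae_of_all _ fun x => (Real.exp_pos _).le), h]
  · congr 1; rw [neg_div_neg_eq]
  · simpa [IntegrableOn] using exp_neg_integrableOn_Ioi a hl

/-- Integration by parts in the Laplace transform of a measure. -/
theorem laplaceM_eq_lintegral_measure_Iio (μ : Measure ℝ) [SFinite μ] (hμ : μ (Iio 0) = 0)
    {lam : ℝ} (hl : 0 < lam) :
    laplaceM μ lam = ENNReal.ofReal lam *
      ∫⁻ s in Ioi (0 : ℝ), ENNReal.ofReal (Real.exp (-(lam * s))) * μ (Iio s) := by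
  have hnn : ∀ᵐ x ∂μ, 0 ≤ x := by
    rw [ae_iff]; simpa [← Iio_def] using hμ
  have h1 : ∀ s, ENNReal.ofReal (Real.exp (-(lam * s))) * μ (Iio s) =
      ∫⁻ x, ENNReal.ofReal (Real.exp (-(lam * s))) * (Iio s).indicator 1 x ∂μ := fun s => by
    rw [lintegral_const_mul _ (measurable_one.indicator measurableSet_Iio),
      lintegral_indicator_one measurableSet_Iio]
  have hmeas : Measurable fun p : ℝ × ℝ => (Iio p.1).indicator (1 : ℝ → ℝ≥0∞) p.2 := by
    have : (fun p : ℝ × ℝ => (Iio p.1).indicator (1 : ℝ → ℝ≥0∞) p.2) =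
        {p : ℝ × ℝ | p.2 < p.1}.indicator 1 := by
      ext p; simp [indicator]
    rw [this]
    exact measurable_one.indicator (measurableSet_lt measurable_snd measurable_fst)
  simp_rw [h1]
  rw [lintegral_lintegral_swap (by fun_prop), laplaceM,
    ← lintegral_const_mul' _ _ ENNReal.ofReal_ne_top]
  refine lintegral_congr_ae (hnn.mono fun x hx => ?_)
  simp only
  have h2 : ∫⁻ s in Ioi (0 : ℝ), ENNReal.ofReal (Real.exp (-(lam * s))) *
      (Iio s).indicator (1 : ℝ → ℝ≥0∞) x =
      ∫⁻ s in Ioi x, ENNReal.ofReal (Real.exp (-(lam * s))) := by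
    rw [← lintegral_indicator measurableSet_Ioi, ← lintegral_indicator measurableSet_Ioi]
    refine lintegral_congr fun s => ?_
    simp only [indicator, mem_Ioi, mem_Iio, Pi.one_apply]
    split_ifs <;> first | (exfalso; linarith) | simp
  rw [h2, lintegral_exp_Ioi hl, ← ENNReal.ofReal_mul hl.le]
  congr 1; field_simp

/-! ### Construction of the subordinator -/

/-- The Stieltjes measure of a bounded nondecreasing function vanishing on `(-∞, 0)`. -/
theorem exists_measure_of_monotone {F : ℝ → ℝ} (hF : Monotone F) (h0 : ∀ x < 0, F x = 0)
    {N : ℝ} (hN : ∀ x, F x ≤ N) :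
    ∃ P : Measure ℝ, P (Iio 0) = 0 ∧ P univ ≤ ENNReal.ofReal N ∧
      ∀ᵐ s, P (Iio s) = ENNReal.ofReal (F s) := by
  have hbot : Tendsto hF.stieltjesFunction atBot (𝓝 0) := by
    refine tendsto_const_nhds.congr' ?_
    filter_upwards [Iio_mem_atBot (0 : ℝ)] with x hx
    rw [hF.stieltjesFunction_eq]
    symm
    refine rightLim_eq_of_tendsto (tendsto_const_nhds.congr' ?_)
    filter_upwards [nhdsWithin_le_nhds (Iio_mem_nhds hx)] with y hy using (h0 y hy).symm
  have hIio : ∀ s, ContinuousAt F s → hF.stieltjesFunction.measure (Iio s) =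
      ENNReal.ofReal (F s) := by
    intro s hs
    rw [StieltjesFunction.measure_Iio _ hbot, sub_zero]
    congr 1
    refine leftLim_eq_of_tendsto ?_
    refine tendsto_of_tendsto_of_tendsto_of_le_of_le' (hs.tendsto.mono_left nhdsWithin_le_nhds)
      tendsto_const_nhds (Eventually.of_forall fun x => ?_) ?_
    · rw [hF.stieltjesFunction_eq]; exact hF.le_rightLim le_rfl
    · filter_upwards [self_mem_nhdsWithin] with x hx
      rw [hF.stieltjesFunction_eq]; exact hF.rightLim_le hx
  -- A monotone function has only countably many discontinuities, so one-sided conventions do not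
  -- matter almost everywhere.
  have hae : ∀ᵐ s : ℝ, ContinuousAt F s := by
    rw [ae_iff]; exact hF.countable_not_continuousAt.measure_zero _
  refine ⟨hF.stieltjesFunction.measure, ?_, ?_, hae.mono hIio⟩
  · rw [StieltjesFunction.measure_Iio _ hbot, sub_zero, ENNReal.ofReal_eq_zero]
    have : Function.leftLim hF.stieltjesFunction 0 = 0 := by
      refine leftLim_eq_of_tendsto (tendsto_const_nhds.congr' ?_)
      filter_upwards [self_mem_nhdsWithin] with x hx
      rw [hF.stieltjesFunction_eq]
      symm
      refine rightLim_eq_of_tendsto (tendsto_const_nhds.congr' ?_)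
      filter_upwards [nhdsWithin_le_nhds (Iio_mem_nhds hx)] with y hy using (h0 y hy).symm
    exact this.le
  · have : (univ : Set ℝ) = ⋃ n : ℕ, Iic (n : ℝ) := by
      ext x; simpa using exists_nat_ge x
    rw [this]
    have hm : Monotone fun n : ℕ => Iic (n : ℝ) := fun a b h => Iic_subset_Iic.2 (by exact_mod_cast h)
    rw [hm.measure_iUnion]
    refine iSup_le fun n => ?_
    rw [StieltjesFunction.measure_Iic _ hbot, sub_zero, hF.stieltjesFunction_eq]
    exact ENNReal.ofReal_le_ofReal ((hF.rightLim_le (lt_add_one _)).trans (hN _))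

/-- If $x,y\ge0$ and $x+y<t$, then $x<t$ and $y<t$. This elementary inclusion is the source of the
submultiplicativity of $w(t,\cdot)$. -/
theorem conv_Iio_le {μ ν : Measure ℝ} [SFinite μ] [SFinite ν] (hμ : μ (Iio 0) = 0)
    (hν : ν (Iio 0) = 0) (t : ℝ) : (μ.conv ν) (Iio t) ≤ μ (Iio t) * ν (Iio t) := by
  rw [Measure.conv, Measure.map_apply (by fun_prop) measurableSet_Iio]
  have hsub : (fun x : ℝ × ℝ => x.1 + x.2) ⁻¹' Iio t ⊆
      (Iio t ×ˢ Iio t) ∪ ((Iio 0 ×ˢ univ) ∪ (univ ×ˢ Iio 0)) := by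
    rintro ⟨x, y⟩ h
    simp only [mem_preimage, mem_Iio, mem_union, mem_prod, mem_univ, and_true, true_and] at h ⊢
    by_contra! hc
    rcases hc with ⟨h1, h2, h3⟩
    exact absurd (h1 (by linarith)) (by linarith)
  refine (measure_mono hsub).trans ((measure_union_le _ _).trans ?_)
  have : (μ.prod ν) ((Iio 0 ×ˢ univ) ∪ (univ ×ˢ Iio 0)) = 0 := by
    refine measure_union_null ?_ ?_ <;> simp [Measure.prod_prod, hμ, hν]
  rw [this, add_zero, Measure.prod_prod]

theorem laplaceM_smul (c : ℝ≥0∞) (μ : Measure ℝ) (lam : ℝ) :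
    laplaceM (c • μ) lam = c * laplaceM μ lam := by
  simp [laplaceM]

/-- The compound Poisson law with jump measure `ν`. -/
theorem exists_compoundPoisson (ν : Measure ℝ) [IsFiniteMeasure ν] (hν : ν (Iio 0) = 0)
    (N : ℝ) {τ : ℝ} (hτ : 0 ≤ τ) :
    ∃ P : Measure ℝ, P (Iio 0) = 0 ∧ ∀ lam, 0 < lam → laplaceM ν lam ≠ ∞ →
      laplaceM P lam = ENNReal.ofReal (Real.exp (-(τ * (N - (laplaceM ν lam).toReal)))) := by
  obtain ⟨c, hc0, hcs⟩ : ∃ c : ℕ → Measure ℝ, c 0 = Measure.dirac 0 ∧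
      ∀ j, c (j + 1) = ν.conv (c j) :=
    ⟨fun j => Nat.rec (Measure.dirac 0) (fun _ η => ν.conv η) j, rfl, fun j => rfl⟩
  have hfin (j : ℕ) : IsFiniteMeasure (c j) := by
    induction j with
    | zero => rw [hc0]; infer_instance
    | succ j ih => rw [hcs]; exact Measure.finite_of_finite_conv ν (c j)
  have hsupp : ∀ j, c j (Iio 0) = 0 := by
    intro j
    induction j with
    | zero => rw [hc0]; simp
    | succ j ih =>
      rw [hcs]
      exact le_antisymm ((conv_Iio_le hν ih 0).trans (by simp [hν])) zero_le
  have hlap : ∀ j lam, laplaceM (c j) lam = laplaceM ν lam ^ j := by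
    intro j lam
    induction j with
    | zero => rw [hc0]; simp [laplaceM]
    | succ j ih => rw [hcs, laplaceM_conv, ih, pow_succ']
  -- Poisson weights with rate $N$, which is not required to be the total mass of $\nu$; when the
  -- mass is smaller, the missing part acts as killing.
  refine ⟨Measure.sum fun j : ℕ =>
    ENNReal.ofReal (Real.exp (-(τ * N)) * (τ ^ j / j.factorial)) • c j, ?_, ?_⟩
  · rw [Measure.sum_apply _ measurableSet_Iio]
    simp [hsupp]
  · intro lam hl hne
    rw [laplaceM, lintegral_sum_measure]
    change ∑' j : ℕ, laplaceM (_ • c j) lam = _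
    set a := (laplaceM ν lam).toReal with ha
    have ha' : laplaceM ν lam = ENNReal.ofReal a := (ENNReal.ofReal_toReal hne).symm
    have ha0 : 0 ≤ a := ENNReal.toReal_nonneg
    have hterm : ∀ j : ℕ, laplaceM
        (ENNReal.ofReal (Real.exp (-(τ * N)) * (τ ^ j / j.factorial)) • c j) lam =
        ENNReal.ofReal (Real.exp (-(τ * N)) * ((τ * a) ^ j / j.factorial)) := by
      intro j
      rw [laplaceM_smul, hlap, ha', ← ENNReal.ofReal_pow ha0, ← ENNReal.ofReal_mul (by positivity)]
      congr 1; rw [mul_pow]; ring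
    simp_rw [hterm]
    have hs : HasSum (fun j : ℕ => Real.exp (-(τ * N)) * ((τ * a) ^ j / j.factorial))
        (Real.exp (-(τ * N)) * Real.exp (τ * a)) := by
      refine HasSum.mul_left _ ?_
      have := NormedSpace.expSeries_div_hasSum_exp (𝔸 := ℝ) (τ * a)
      rwa [← Real.exp_eq_exp_ℝ] at this
    rw [← ENNReal.ofReal_tsum_of_nonneg (fun j => by positivity) hs.summable, hs.tsum_eq,
      ← Real.exp_add]
    congr 2; ring

/-- Chernoff's bound: $1_{x<a}\le e^{\lambda(a-x)}$, and then $\lambda\downarrow0$. -/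
theorem measure_Iio_le_one_of_laplaceM {P : Measure ℝ} (h : ∀ lam, 0 < lam → laplaceM P lam ≤ 1)
    (a : ℝ) : P (Iio a) ≤ 1 := by
  have h1 : ∀ lam, 0 < lam → P (Iio a) ≤ ENNReal.ofReal (Real.exp (lam * a)) := by
    intro lam hl
    calc P (Iio a) = ∫⁻ x in Iio a, 1 ∂P := by simp
      _ ≤ ∫⁻ x in Iio a, ENNReal.ofReal (Real.exp (lam * a)) *
          ENNReal.ofReal (Real.exp (-(lam * x))) ∂P := by
        refine setLIntegral_mono (by fun_prop) fun x hx => ?_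
        rw [← ENNReal.ofReal_mul (Real.exp_pos _).le, ← Real.exp_add, ENNReal.one_le_ofReal,
          Real.one_le_exp_iff]
        have := mul_lt_mul_of_pos_left (mem_Iio.1 hx) hl
        linarith
      _ ≤ ∫⁻ x, ENNReal.ofReal (Real.exp (lam * a)) *
          ENNReal.ofReal (Real.exp (-(lam * x))) ∂P := setLIntegral_le_lintegral _ _
      _ = ENNReal.ofReal (Real.exp (lam * a)) * laplaceM P lam :=
        lintegral_const_mul _ (by fun_prop)
      _ ≤ ENNReal.ofReal (Real.exp (lam * a)) * 1 := by gcongr; exact h lam hl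
      _ = _ := mul_one _
  have ht : Tendsto (fun lam => ENNReal.ofReal (Real.exp (lam * a))) (𝓝[>] 0) (𝓝 1) := by
    have : Tendsto (fun lam => ENNReal.ofReal (Real.exp (lam * a))) (𝓝 0)
        (𝓝 (ENNReal.ofReal (Real.exp (0 * a)))) :=
      ENNReal.tendsto_ofReal ((by fun_prop : Continuous fun lam : ℝ => Real.exp (lam * a)).tendsto 0)
    simpa using this.mono_left nhdsWithin_le_nhds
  refine ge_of_tendsto ht ?_
  filter_upwards [self_mem_nhdsWithin] with lam hl using h1 lam hl

theorem measure_univ_le_one_of_laplaceM {P : Measure ℝ} (h : ∀ lam, 0 < lam → laplaceM P lam ≤ 1) :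
    P univ ≤ 1 := by
  have : (univ : Set ℝ) = ⋃ n : ℕ, Iio (n : ℝ) := by
    ext x; simpa using exists_nat_gt x
  have hm : Monotone fun n : ℕ => Iio (n : ℝ) :=
    fun a b h => Iio_subset_Iio (by exact_mod_cast h)
  rw [this, hm.measure_iUnion]
  exact iSup_le fun n => measure_Iio_le_one_of_laplaceM h _

theorem integrableOn_exp_mul_of_bounded {κ : ℝ → ℝ} {N : ℝ} (hm : AntitoneOn κ (Ioi 0))
    (h0 : ∀ t, 0 < t → 0 ≤ κ t) (hN : ∀ t, 0 < t → κ t ≤ N) {lam : ℝ} (hl : 0 < lam) :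
    IntegrableOn (fun t => Real.exp (-(lam * t)) * κ t) (Ioi 0) := by
  have hi : IntegrableOn (fun t => Real.exp (-(lam * t)) * N) (Ioi 0) :=
    Integrable.mul_const (by simpa [IntegrableOn] using exp_neg_integrableOn_Ioi 0 hl) N
  refine Integrable.mono' hi ?_ ?_
  · exact ((by fun_prop : Measurable fun t : ℝ => Real.exp (-(lam * t))).aemeasurable.mul
      (aemeasurable_restrict_of_antitoneOn measurableSet_Ioi hm)).aestronglyMeasurable
  · refine (ae_restrict_iff' measurableSet_Ioi).2 (ae_of_all _ fun t ht => ?_)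
    rw [Real.norm_of_nonneg (mul_nonneg (Real.exp_pos _).le (h0 t ht))]
    exact mul_le_mul_of_nonneg_left (hN t ht) (Real.exp_pos _).le

theorem integral_exp_mul_Ioi_zero {lam : ℝ} (hl : 0 < lam) :
    ∫ t in Ioi (0 : ℝ), Real.exp (-(lam * t)) = 1 / lam := by
  have h := integral_exp_mul_Ioi (a := -lam) (by linarith) 0
  simp only [neg_mul] at h
  rw [h]; simp

theorem laplace_nonneg {κ : ℝ → ℝ} (h0 : ∀ t, 0 < t → 0 ≤ κ t) (lam : ℝ) : 0 ≤ laplace κ lam :=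
  setIntegral_nonneg measurableSet_Ioi fun t ht => mul_nonneg (Real.exp_pos _).le (h0 t ht)

theorem ofReal_laplace {κ : ℝ → ℝ} {lam : ℝ} (h0 : ∀ t, 0 < t → 0 ≤ κ t)
    (hi : IntegrableOn (fun t => Real.exp (-(lam * t)) * κ t) (Ioi 0)) :
    ENNReal.ofReal (laplace κ lam) =
      ∫⁻ t in Ioi (0 : ℝ), ENNReal.ofReal (Real.exp (-(lam * t))) * ENNReal.ofReal (κ t) := by
  rw [laplace, ofReal_integral_eq_lintegral_ofReal hi]
  · exact lintegral_congr fun t => ENNReal.ofReal_mul (Real.exp_pos _).le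
  · exact (ae_restrict_iff' measurableSet_Ioi).2
      (ae_of_all _ fun t ht => mul_nonneg (Real.exp_pos _).le (h0 t ht))

/-- For bounded $\kappa$, the function $N-\kappa$ is the distribution function of a finite jump
measure. Integration by parts gives that measure the transform $N-\lambda\hat\kappa(\lambda)$, so
its compound Poisson law has exponent $\lambda\hat\kappa(\lambda)$. -/
theorem exists_subordinator_of_bounded {κ : ℝ → ℝ} {N : ℝ} (hm : AntitoneOn κ (Ioi 0))
    (h0 : ∀ t, 0 < t → 0 ≤ κ t) (hN : ∀ t, 0 < t → κ t ≤ N) {τ : ℝ} (hτ : 0 ≤ τ) :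
    ∃ P : Measure ℝ, P (Iio 0) = 0 ∧ ∀ lam, 0 < lam →
      laplaceM P lam = ENNReal.ofReal (Real.exp (-(τ * (lam * laplace κ lam)))) := by
  classical
  have hN0 : 0 ≤ N := (h0 1 one_pos).trans (hN 1 one_pos)
  -- The possible jump of `F` at $0$ is an atom of zero-size jumps, which is harmless.
  let F : ℝ → ℝ := fun x => if x ≤ 0 then 0 else N - κ x
  have hF : Monotone F := by
    intro x y hxy
    simp only [F]
    split_ifs with h1 h2 h2
    · exact le_rfl
    · linarith [hN y (not_le.1 h2)]
    · linarith
    · linarith [hm (mem_Ioi.2 (not_le.1 h1)) (mem_Ioi.2 (not_le.1 h2)) hxy]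
  obtain ⟨ν, hν, hνu, hνF⟩ := exists_measure_of_monotone hF (fun x hx => by simp [F, hx.le])
    (N := N) (fun x => by
      simp only [F]
      split_ifs with h1
      · exact hN0
      · linarith [h0 x (not_le.1 h1)])
  have : IsFiniteMeasure ν := ⟨hνu.trans_lt ENNReal.ofReal_lt_top⟩
  have hlap : ∀ lam, 0 < lam → laplaceM ν lam = ENNReal.ofReal (N - lam * laplace κ lam) := by
    intro lam hl
    have hiκ := integrableOn_exp_mul_of_bounded hm h0 hN hl
    have hiN : IntegrableOn (fun t => Real.exp (-(lam * t)) * N) (Ioi 0) :=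
      Integrable.mul_const (by simpa [IntegrableOn] using exp_neg_integrableOn_Ioi 0 hl) N
    rw [laplaceM_eq_lintegral_measure_Iio ν hν hl]
    have h1 : ∫⁻ s in Ioi (0 : ℝ), ENNReal.ofReal (Real.exp (-(lam * s))) * ν (Iio s) =
        ENNReal.ofReal (∫ s in Ioi (0 : ℝ),
          (Real.exp (-(lam * s)) * N - Real.exp (-(lam * s)) * κ s)) := by
      have hd : Integrable (fun s => Real.exp (-(lam * s)) * N - Real.exp (-(lam * s)) * κ s)
          (volume.restrict (Ioi 0)) := hiN.sub hiκ
      rw [ofReal_integral_eq_lintegral_ofReal hd]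
      · refine lintegral_congr_ae ?_
        filter_upwards [ae_restrict_of_ae hνF, ae_restrict_mem measurableSet_Ioi] with s hs hs0
        rw [hs, ← ENNReal.ofReal_mul (Real.exp_pos _).le]
        simp only [F, if_neg (not_le.2 (mem_Ioi.1 hs0)), mul_sub]
      · filter_upwards [ae_restrict_mem measurableSet_Ioi] with s hs0
        rw [← mul_sub]
        exact mul_nonneg (Real.exp_pos _).le (sub_nonneg.2 (hN s hs0))
    rw [h1, integral_sub hiN hiκ, ← ENNReal.ofReal_mul hl.le, integral_mul_const,
      integral_exp_mul_Ioi_zero hl]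
    congr 1
    rw [mul_sub]
    congr 1
    field_simp
  have hle : ∀ lam, 0 < lam → 0 ≤ N - lam * laplace κ lam := by
    intro lam hl
    have : laplace κ lam ≤ ∫ t in Ioi (0 : ℝ), Real.exp (-(lam * t)) * N := by
      refine setIntegral_mono_on (integrableOn_exp_mul_of_bounded hm h0 hN hl)
        (Integrable.mul_const (by simpa [IntegrableOn] using exp_neg_integrableOn_Ioi 0 hl) N)
        measurableSet_Ioi fun t ht => ?_
      exact mul_le_mul_of_nonneg_left (hN t ht) (Real.exp_pos _).le
    rw [integral_mul_const, integral_exp_mul_Ioi_zero hl] at this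
    have := mul_le_mul_of_nonneg_left this hl.le
    have h2 : lam * (1 / lam * N) = N := by field_simp
    linarith
  obtain ⟨P, hP, hPl⟩ := exists_compoundPoisson ν hν N hτ
  refine ⟨P, hP, fun lam hl => ?_⟩
  rw [hPl lam hl (by rw [hlap lam hl]; exact ENNReal.ofReal_ne_top), hlap lam hl,
    ENNReal.toReal_ofReal (hle lam hl)]
  congr 3; ring

/-- The law at time `τ` of the subordinator whose Laplace exponent is `lam ↦ lam k̂(lam)`. -/
theorem exists_subordinator {k : ℝ → ℝ} (hm : AntitoneOn k (Ioi 0))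
    (h0 : ∀ t, 0 < t → 0 ≤ k t)
    (hi : ∀ lam, 0 < lam → IntegrableOn (fun t => Real.exp (-(lam * t)) * k t) (Ioi 0))
    {τ : ℝ} (hτ : 0 ≤ τ) :
    ∃ P : Measure ℝ, P (Iio 0) = 0 ∧ ∀ lam, 0 < lam →
      laplaceM P lam = ENNReal.ofReal (Real.exp (-(τ * (lam * laplace k lam)))) := by
  let kn : ℕ → ℝ → ℝ := fun n t => min (k t) n
  have kn_anti : ∀ n, AntitoneOn (kn n) (Ioi 0) := fun n x hx y hy hxy =>
    min_le_min (hm hx hy hxy) le_rfl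
  have kn_nn : ∀ n t, 0 < t → 0 ≤ kn n t := fun n t ht => le_min (h0 t ht) n.cast_nonneg
  have kn_le : ∀ n t, 0 < t → kn n t ≤ n := fun n t _ => min_le_right _ _
  choose P hP hPl using fun n => exists_subordinator_of_bounded (kn_anti n) (kn_nn n) (kn_le n) hτ
  -- The increments of the truncations are again nonincreasing with values in $[0,1]$, hence
  -- exponents of laws `Q n`. Therefore `P (n + 1)` is `P n` convolved with `Q n`, and the
  -- distribution functions decrease in $n$; the limit exists pointwise with no compactness
  -- argument.
  let qn : ℕ → ℝ → ℝ := fun n t => kn (n + 1) t - kn n t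
  have qn_eq : ∀ n t, qn n t = max (min (k t - n) 1) 0 := by
    intro n t
    simp only [qn, kn]; push_cast
    rcases le_total (k t) n with h | h
    · rw [min_eq_left h, min_eq_left (by linarith), min_eq_left (by linarith),
        max_eq_right (by linarith), sub_self]
    · rw [min_eq_right h]
      rcases le_total (k t) (n + 1) with h' | h'
      · rw [min_eq_left h', min_eq_left (by linarith), max_eq_left (by linarith)]
      · rw [min_eq_right h', min_eq_right (by linarith), max_eq_left (by linarith)]; ring
  have qn_anti : ∀ n, AntitoneOn (qn n) (Ioi 0) := fun n x hx y hy hxy => by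
    rw [qn_eq, qn_eq]
    exact max_le_max (min_le_min (sub_le_sub_right (hm hx hy hxy) _) le_rfl) le_rfl
  choose Q hQ hQl using fun n => exists_subordinator_of_bounded (N := 1) (qn_anti n)
    (fun t _ => by rw [qn_eq]; exact le_max_right _ _)
    (fun t _ => by rw [qn_eq]; exact max_le (min_le_right _ _) zero_le_one) hτ
  have hle1 : ∀ {κ : ℝ → ℝ}, (∀ t, 0 < t → 0 ≤ κ t) → ∀ lam, 0 < lam →
      ENNReal.ofReal (Real.exp (-(τ * (lam * laplace κ lam)))) ≤ 1 := by
    intro κ hκ lam hl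
    rw [ENNReal.ofReal_le_one, Real.exp_le_one_iff, neg_nonpos]
    exact mul_nonneg hτ (mul_nonneg hl.le (laplace_nonneg hκ lam))
  have hP1 : ∀ n lam, 0 < lam → laplaceM (P n) lam ≤ 1 := fun n lam hl => by
    rw [hPl n lam hl]; exact hle1 (kn_nn n) lam hl
  have hQ1 : ∀ n lam, 0 < lam → laplaceM (Q n) lam ≤ 1 := fun n lam hl => by
    rw [hQl n lam hl]
    exact hle1 (fun t _ => by rw [qn_eq]; exact le_max_right _ _) lam hl
  have fP : ∀ n, IsFiniteMeasure (P n) := fun n =>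
    ⟨(measure_univ_le_one_of_laplaceM (hP1 n)).trans_lt ENNReal.one_lt_top⟩
  have fQ : ∀ n, IsFiniteMeasure (Q n) := fun n =>
    ⟨(measure_univ_le_one_of_laplaceM (hQ1 n)).trans_lt ENNReal.one_lt_top⟩
  have hconv : ∀ n, P (n + 1) = (P n).conv (Q n) := by
    intro n
    refine laplaceM_ext (hP _) (le_antisymm ((conv_Iio_le (hP n) (hQ n) 0).trans
      (by simp [hP])) zero_le) ((hP1 _ 1 one_pos).trans_lt ENNReal.one_lt_top).ne fun lam hl => ?_
    rw [laplaceM_conv, hPl _ lam hl, hPl _ lam hl, hQl _ lam hl,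
      ← ENNReal.ofReal_mul (Real.exp_pos _).le, ← Real.exp_add]
    have : laplace (qn n) lam = laplace (kn (n + 1)) lam - laplace (kn n) lam := by
      simp only [laplace]
      rw [← integral_sub
        (integrableOn_exp_mul_of_bounded (kn_anti _) (kn_nn _) (kn_le _) hl)
        (integrableOn_exp_mul_of_bounded (kn_anti _) (kn_nn _) (kn_le _) hl)]
      simp only [qn, mul_sub]
    rw [this]
    congr 2; ring
  have hdec : ∀ s, Antitone fun n => P n (Iio s) := fun s => antitone_nat_of_succ_le fun n => by
    rw [hconv]
    refine (conv_Iio_le (hP n) (hQ n) s).trans ?_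
    exact mul_le_of_le_one_right' (measure_Iio_le_one_of_laplaceM (hQ1 n) s)
  let F : ℝ → ℝ := fun s => (⨅ n, P n (Iio s)).toReal
  have hFle : ∀ s, ⨅ n, P n (Iio s) ≤ 1 := fun s =>
    (iInf_le _ 0).trans (measure_Iio_le_one_of_laplaceM (hP1 0) s)
  have hFne : ∀ s, ⨅ n, P n (Iio s) ≠ ∞ := fun s => ((hFle s).trans_lt ENNReal.one_lt_top).ne
  have hFm : Monotone F := fun s t hst => ENNReal.toReal_mono (hFne t)
    (iInf_mono fun n => measure_mono (Iio_subset_Iio hst))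
  obtain ⟨R, hR, hRu, hRF⟩ := exists_measure_of_monotone hFm (N := 1)
    (fun x hx => by
      have : ⨅ n, P n (Iio x) = 0 := le_antisymm ((iInf_le _ 0).trans
        ((measure_mono (Iio_subset_Iio hx.le)).trans (hP 0).le)) zero_le
      simp [F, this])
    (fun x => ENNReal.toReal_le_of_le_ofReal zero_le_one (by simpa using hFle x))
  have fR : IsFiniteMeasure R := ⟨hRu.trans_lt ENNReal.ofReal_lt_top⟩
  refine ⟨R, hR, fun lam hl => ?_⟩
  have hkn : Tendsto (fun n => laplace (kn n) lam) atTop (𝓝 (laplace k lam)) := by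
    refine tendsto_integral_of_dominated_convergence (fun t => Real.exp (-(lam * t)) * k t)
      (fun n => (integrableOn_exp_mul_of_bounded (kn_anti n) (kn_nn n) (kn_le n)
        hl).aestronglyMeasurable) (hi lam hl) (fun n => ?_) (ae_of_all _ fun t => ?_)
    · filter_upwards [ae_restrict_mem measurableSet_Ioi] with t ht
      rw [Real.norm_of_nonneg (mul_nonneg (Real.exp_pos _).le (kn_nn n t ht))]
      exact mul_le_mul_of_nonneg_left (min_le_left _ _) (Real.exp_pos _).le
    · refine tendsto_const_nhds.congr' ?_
      obtain ⟨m, hm⟩ := exists_nat_ge (k t)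
      filter_upwards [eventually_ge_atTop m] with n hn
      have : k t ≤ n := hm.trans (by exact_mod_cast hn)
      simp [kn, min_eq_left this]
  have hT1 : Tendsto (fun n => laplaceM (P n) lam) atTop
      (𝓝 (ENNReal.ofReal (Real.exp (-(τ * (lam * laplace k lam)))))) := by
    simp_rw [hPl _ lam hl]
    refine ENNReal.tendsto_ofReal ?_
    exact (Real.continuous_exp.tendsto _).comp ((hkn.const_mul lam).const_mul τ).neg
  -- Integration by parts expresses the transform through distribution functions, which converge
  -- almost everywhere under the majorant $e^{-\lambda s}$.
  have hT2 : Tendsto (fun n => laplaceM (P n) lam) atTop (𝓝 (laplaceM R lam)) := by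
    simp_rw [fun n => laplaceM_eq_lintegral_measure_Iio (P n) (hP n) hl,
      laplaceM_eq_lintegral_measure_Iio R hR hl]
    refine ENNReal.Tendsto.const_mul ?_ (Or.inr ENNReal.ofReal_ne_top)
    refine tendsto_lintegral_of_dominated_convergence
      (fun s => ENNReal.ofReal (Real.exp (-(lam * s)))) (fun n => ?_) (fun n => ?_) ?_ ?_
    · have : Monotone fun s => P n (Iio s) := fun s t hst => measure_mono (Iio_subset_Iio hst)
      exact (by fun_prop : Measurable fun s : ℝ => ENNReal.ofReal (Real.exp (-(lam * s)))).mul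
        this.measurable
    · exact ae_of_all _ fun s => mul_le_of_le_one_right' (measure_Iio_le_one_of_laplaceM (hP1 n) s)
    · rw [lintegral_exp_Ioi hl]; exact ENNReal.ofReal_ne_top
    · filter_upwards [ae_restrict_of_ae hRF] with s hs
      rw [hs, ENNReal.ofReal_toReal (hFne s)]
      exact ENNReal.Tendsto.const_mul (tendsto_atTop_iInf (hdec s)) (Or.inr ENNReal.ofReal_ne_top)
  exact tendsto_nhds_unique hT2 hT1

/-- Local integrability controls $(0,1]$; beyond $1$ the kernel is bounded by $k(1)$. -/
theorem IsPC.integrableOn_exp_mul {k l : ℝ → ℝ} (h : IsPC k l) {lam : ℝ} (hl : 0 < lam) :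
    IntegrableOn (fun t => Real.exp (-(lam * t)) * k t) (Ioi 0) := by
  have h1 : IntegrableOn (fun t => Real.exp (-(lam * t)) * k t) (Ioc 0 1) := by
    have hk : IntegrableOn k (Ioc 0 1) :=
      (h.locInt_k.integrableOn_compact_subset Icc_subset_Ici_self isCompact_Icc).mono_set
        Ioc_subset_Icc_self
    refine Integrable.bdd_mul (c := 1) hk (by fun_prop) ?_
    filter_upwards [ae_restrict_mem measurableSet_Ioc] with t ht
    rw [Real.norm_of_nonneg (Real.exp_pos _).le, Real.exp_le_one_iff, neg_nonpos]
    exact mul_nonneg hl.le ht.1.le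
  have h2 : IntegrableOn (fun t => Real.exp (-(lam * t)) * k t) (Ioi 1) := by
    have h3 := integrableOn_exp_mul_of_bounded (κ := fun t => min (k t) (k 1)) (N := k 1)
      (fun x hx y hy hxy => min_le_min (h.anti_k hx hy hxy) le_rfl)
      (fun t ht => le_min (h.nonneg_k t ht) (h.nonneg_k 1 one_pos)) (fun t _ => min_le_right _ _) hl
    refine (h3.mono_set (Ioi_subset_Ioi zero_le_one)).congr_fun (fun t ht => ?_) measurableSet_Ioi
    have : k t ≤ k 1 := h.anti_k (mem_Ioi.2 one_pos) (mem_Ioi.2 (one_pos.trans ht)) (mem_Ioi.1 ht).le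
    simp [min_eq_left this]
  rw [← Ioc_union_Ioi_eq_Ioi (zero_le_one (α := ℝ))]
  exact h1.union h2

/-! ### The convolution semigroup and its monotonicity -/

/-- The law at time `τ` of the subordinator with Laplace exponent `lam ↦ lam k̂(lam)`. -/
noncomputable def subordinator (k : ℝ → ℝ) (τ : ℝ) : Measure ℝ :=
  Classical.epsilon fun P : Measure ℝ => P (Iio 0) = 0 ∧ ∀ lam, 0 < lam →
    laplaceM P lam = ENNReal.ofReal (Real.exp (-(τ * (lam * laplace k lam))))

section

variable {k l : ℝ → ℝ}

theorem IsPC.subordinator_spec (h : IsPC k l) {τ : ℝ} (hτ : 0 ≤ τ) :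
    subordinator k τ (Iio 0) = 0 ∧ ∀ lam, 0 < lam →
      laplaceM (subordinator k τ) lam =
        ENNReal.ofReal (Real.exp (-(τ * (lam * laplace k lam)))) :=
  Classical.epsilon_spec (exists_subordinator h.anti_k h.nonneg_k
    (fun _ hl => h.integrableOn_exp_mul hl) hτ)

theorem IsPC.laplaceM_subordinator_le_one (h : IsPC k l) {τ : ℝ} (hτ : 0 ≤ τ) {lam : ℝ}
    (hl : 0 < lam) : laplaceM (subordinator k τ) lam ≤ 1 := by
  rw [(h.subordinator_spec hτ).2 lam hl, ENNReal.ofReal_le_one, Real.exp_le_one_iff, neg_nonpos]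
  exact mul_nonneg hτ (mul_nonneg hl.le (laplace_nonneg h.nonneg_k lam))

theorem IsPC.subordinator_univ_le (h : IsPC k l) {τ : ℝ} (hτ : 0 ≤ τ) :
    subordinator k τ univ ≤ 1 :=
  measure_univ_le_one_of_laplaceM fun _ hl => h.laplaceM_subordinator_le_one hτ hl

theorem IsPC.isFiniteMeasure_subordinator (h : IsPC k l) {τ : ℝ} (hτ : 0 ≤ τ) :
    IsFiniteMeasure (subordinator k τ) :=
  ⟨(h.subordinator_univ_le hτ).trans_lt ENNReal.one_lt_top⟩

theorem IsPC.subordinator_le_one (h : IsPC k l) {τ : ℝ} (hτ : 0 ≤ τ) (s : Set ℝ) :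
    subordinator k τ s ≤ 1 :=
  (measure_mono (subset_univ _)).trans (h.subordinator_univ_le hτ)

/-- The exponents add, so uniqueness of the Laplace transform gives the semigroup law, and
`conv_Iio_le` applies to the convolution. -/
theorem IsPC.subordinator_Iio_add_le (h : IsPC k l) {a b : ℝ} (ha : 0 ≤ a) (hb : 0 ≤ b) (t : ℝ) :
    subordinator k (a + b) (Iio t) ≤ subordinator k a (Iio t) * subordinator k b (Iio t) := by
  have := h.isFiniteMeasure_subordinator ha
  have := h.isFiniteMeasure_subordinator hb
  have sa := h.subordinator_spec ha
  have sb := h.subordinator_spec hb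
  have sab := h.subordinator_spec (add_nonneg ha hb)
  have : subordinator k (a + b) = (subordinator k a).conv (subordinator k b) := by
    refine laplaceM_ext sab.1 (le_antisymm ((conv_Iio_le sa.1 sb.1 0).trans
      (by simp [sa.1])) zero_le) ((h.laplaceM_subordinator_le_one (add_nonneg ha hb)
        one_pos).trans_lt ENNReal.one_lt_top).ne fun lam hl => ?_
    rw [laplaceM_conv, sa.2 lam hl, sb.2 lam hl, sab.2 lam hl,
      ← ENNReal.ofReal_mul (Real.exp_pos _).le, ← Real.exp_add]
    congr 2; ring
  rw [this]
  exact conv_Iio_le sa.1 sb.1 t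

theorem IsPC.subordinator_Iio_anti (h : IsPC k l) (t : ℝ) :
    AntitoneOn (fun τ => subordinator k τ (Iio t)) (Ici 0) := by
  intro a ha b hb hab
  have := h.subordinator_Iio_add_le (mem_Ici.1 ha) (sub_nonneg.2 hab) t
  rw [add_sub_cancel] at this
  exact this.trans (mul_le_of_le_one_right' (h.subordinator_le_one (sub_nonneg.2 hab) _))

theorem measure_Iio_eq_iSup_rat (P : Measure ℝ) (t : ℝ) :
    P (Iio t) = ⨆ q : {q : ℚ // (q : ℝ) < t}, P (Iio (q : ℝ)) := by
  have : Iio t = ⋃ q : {q : ℚ // (q : ℝ) < t}, Iio ((q : ℚ) : ℝ) := by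
    ext x
    simp only [mem_Iio, mem_iUnion, Subtype.exists, exists_prop]
    constructor
    · intro hx
      obtain ⟨q, h1, h2⟩ := exists_rat_btwn hx
      exact ⟨q, h2, h1⟩
    · rintro ⟨q, h1, h2⟩; exact h2.trans h1
  conv_lhs => rw [this]
  refine Monotone.directed_le (f := fun q : {q : ℚ // (q : ℝ) < t} => Iio ((q : ℚ) : ℝ)) ?_
    |>.measure_iUnion
  intro a b hab
  exact Iio_subset_Iio (by exact_mod_cast hab)

/-- Continuity from below along rationals writes each superlevel set as a countable union of
rectangles, whose $\tau$-sides are measurable by monotonicity. The `max` keeps clear of negative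
times, where the law is unspecified. -/
theorem IsPC.measurable_subordinator_Iio (h : IsPC k l) :
    Measurable fun p : ℝ × ℝ => subordinator k (max p.2 0) (Iio p.1) := by
  refine measurable_of_Ioi fun c => ?_
  have : (fun p : ℝ × ℝ => subordinator k (max p.2 0) (Iio p.1)) ⁻¹' Ioi c =
      ⋃ q : ℚ, Ioi (q : ℝ) ×ˢ ((fun τ => subordinator k (max τ 0) (Iio (q : ℝ))) ⁻¹' Ioi c) := by
    ext ⟨t, τ⟩
    simp only [mem_preimage, mem_Ioi, mem_iUnion, mem_prod]
    rw [measure_Iio_eq_iSup_rat, lt_iSup_iff]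
    simp
  rw [this]
  refine MeasurableSet.iUnion fun q => measurableSet_Ioi.prod ?_
  have hm : Antitone fun τ => subordinator k (max τ 0) (Iio (q : ℝ)) := fun a b hab =>
    h.subordinator_Iio_anti q (mem_Ici.2 (le_max_right _ _)) (mem_Ici.2 (le_max_right _ _))
      (max_le_max hab le_rfl)
  exact hm.measurable measurableSet_Ioi

/-! ### Identification of the propagation function -/

theorem IsPC.isPropagation_subordinator (h : IsPC k l) {τ : ℝ} (hτ : 0 ≤ τ) :
    IsPropagation k τ fun t => (subordinator k τ).real (Iio t) := by
  have := h.isFiniteMeasure_subordinator hτ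
  have hs := h.subordinator_spec hτ
  refine ⟨fun a _ b _ hab => measureReal_mono (Iio_subset_Iio hab), by simp [measureReal_def, hs.1],
    fun σ _ => ?_, fun lam hl => ?_⟩
  · refine continuousWithinAt_Iio_iff_Iic.1 ((ENNReal.tendsto_toReal
      (measure_ne_top (subordinator k τ) (Iio σ))).comp (tendsto_order.2 ⟨fun c hc => ?_,
        fun c hc => ?_⟩))
    · rw [measure_Iio_eq_iSup_rat, lt_iSup_iff] at hc
      obtain ⟨q, hq⟩ := hc
      filter_upwards [Ioo_mem_nhdsLT q.2] with s hs
      exact hq.trans_le (measure_mono (Iio_subset_Iio hs.1.le))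
    · filter_upwards [self_mem_nhdsWithin] with s hs
      exact (measure_mono (Iio_subset_Iio (mem_Iio.1 hs).le)).trans_lt hc
  · have hm : Monotone fun s => subordinator k τ (Iio s) :=
      fun a b hab => measure_mono (Iio_subset_Iio hab)
    rw [laplace, integral_eq_lintegral_of_nonneg_ae
      (ae_of_all _ fun t => mul_nonneg (Real.exp_pos _).le measureReal_nonneg)]
    · have h1 := laplaceM_eq_lintegral_measure_Iio _ hs.1 hl
      rw [hs.2 lam hl] at h1
      have h2 : ∀ t, ENNReal.ofReal (Real.exp (-(lam * t)) * (subordinator k τ).real (Iio t)) =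
          ENNReal.ofReal (Real.exp (-(lam * t))) * subordinator k τ (Iio t) := fun t => by
        rw [ENNReal.ofReal_mul (Real.exp_pos _).le, ofReal_measureReal]
      simp_rw [h2]
      have h3 := congrArg ENNReal.toReal h1
      rw [ENNReal.toReal_ofReal (Real.exp_pos _).le, ENNReal.toReal_mul,
        ENNReal.toReal_ofReal hl.le] at h3
      rw [h3]; field_simp
    · exact ((by fun_prop : Measurable fun s : ℝ => Real.exp (-(lam * s))).mul
        hm.measurable.ennreal_toReal).aestronglyMeasurable

/-- For $s<t$ some $r\in(s,t)$ has $v(r)=w(r)$, whence $v(s)\le w(t)$; left-continuity of $v$ lets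
$s\uparrow t$. -/
theorem le_of_ae_eq_of_left_cont {v w : ℝ → ℝ} (hv : MonotoneOn v (Ici 0))
    (hw : MonotoneOn w (Ici 0)) (hc : ∀ σ, 0 < σ → ContinuousWithinAt v (Iic σ) σ)
    (hae : ∀ᵐ t ∂(volume.restrict (Ioi (0 : ℝ))), v t = w t) {t : ℝ} (ht : 0 < t) : v t ≤ w t := by
  have h1 : ∀ s ∈ Ioo 0 t, v s ≤ w t := by
    intro s hs
    have : ∃ r ∈ Ioo s t, v r = w r := by
      have h2 : ∀ᵐ r ∂(volume.restrict (Ioo s t)), v r = w r :=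
        ae_restrict_of_ae_restrict_of_subset (fun r hr => hs.1.trans hr.1) hae
      have h3 : (ae (volume.restrict (Ioo s t))).NeBot := by
        rw [ae_neBot, Ne, Measure.restrict_eq_zero]
        simp [hs.2]
      obtain ⟨r, hr⟩ := (h2.and (ae_restrict_mem measurableSet_Ioo)).exists
      exact ⟨r, hr.2, hr.1⟩
    obtain ⟨r, hr, he⟩ := this
    have hr0 : 0 ≤ r := hs.1.le.trans hr.1.le
    calc v s ≤ v r := hv hs.1.le hr0 hr.1.le
      _ = w r := he
      _ ≤ w t := hw hr0 ht.le hr.2.le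
  have h4 : Tendsto v (𝓝[<] t) (𝓝 (v t)) := (hc t ht).tendsto.mono_left
    (nhdsWithin_mono _ Iio_subset_Iic_self)
  refine le_of_tendsto h4 ?_
  filter_upwards [Ioo_mem_nhdsLT ht] with s hs using h1 s hs

theorem IsPropagation.nonneg {τ : ℝ} {v : ℝ → ℝ} (hv : IsPropagation k τ v) {t : ℝ} (ht : 0 ≤ t) :
    0 ≤ v t := hv.zero ▸ hv.mono (mem_Ici.2 le_rfl) (mem_Ici.2 ht) ht

theorem IsPropagation.aemeasurable {τ : ℝ} {v : ℝ → ℝ} (hv : IsPropagation k τ v) :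
    AEMeasurable v (volume.restrict (Ioi 0)) :=
  aemeasurable_restrict_of_monotoneOn measurableSet_Ioi (hv.mono.mono Ioi_subset_Ici_self)

theorem IsPropagation.laplaceM_withDensity {τ : ℝ} {v : ℝ → ℝ} (hv : IsPropagation k τ v)
    {lam : ℝ} (hl : 0 < lam) :
    laplaceM ((volume.restrict (Ioi 0)).withDensity fun t => ENNReal.ofReal (v t)) lam =
      ENNReal.ofReal (Real.exp (-(τ * (lam * laplace k lam))) / lam) := by
  -- Integrability is implicit in the definition: a divergent integral would have the value $0$,
  -- whereas the prescribed transform is positive.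
  have hi : IntegrableOn (fun t => Real.exp (-(lam * t)) * v t) (Ioi 0) := by
    by_contra hc
    have h1 := hv.laplace_eq lam hl
    rw [laplace, integral_undef hc] at h1
    exact absurd h1 (by positivity)
  rw [← hv.laplace_eq lam hl, ofReal_laplace (fun t ht => hv.nonneg ht.le) hi, laplaceM,
    lintegral_withDensity_eq_lintegral_mul₀ hv.aemeasurable.ennreal_ofReal (by fun_prop)]
  exact lintegral_congr fun t => mul_comm (ENNReal.ofReal (v t)) _

/-- Equal transforms force equal densities almost everywhere; monotonicity and left-continuity
upgrade this to every $t>0$. -/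
theorem IsPropagation.eq {τ : ℝ} {v w : ℝ → ℝ} (hv : IsPropagation k τ v)
    (hw : IsPropagation k τ w) {t : ℝ} (ht : 0 < t) : v t = w t := by
  have hnull : ∀ f : ℝ → ℝ≥0∞, ((volume.restrict (Ioi 0)).withDensity f) (Iio 0) = 0 := by
    intro f
    refine withDensity_absolutelyContinuous _ _ ?_
    rw [Measure.restrict_apply measurableSet_Iio]
    have : Iio (0 : ℝ) ∩ Ioi 0 = ∅ := by ext x; simp; intro h; linarith
    simp [this]
  have heq := laplaceM_ext (hnull fun t => ENNReal.ofReal (v t))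
    (hnull fun t => ENNReal.ofReal (w t))
    (by rw [hv.laplaceM_withDensity one_pos]; exact ENNReal.ofReal_ne_top)
    (fun lam hl => by rw [hv.laplaceM_withDensity hl, hw.laplaceM_withDensity hl])
  rw [withDensity_eq_iff_of_sigmaFinite hv.aemeasurable.ennreal_ofReal
    hw.aemeasurable.ennreal_ofReal] at heq
  have hae : ∀ᵐ t ∂(volume.restrict (Ioi (0 : ℝ))), v t = w t := by
    filter_upwards [heq, ae_restrict_mem measurableSet_Ioi] with t h1 h2
    exact (ENNReal.ofReal_eq_ofReal_iff (hv.nonneg (mem_Ioi.1 h2).le)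
      (hw.nonneg (mem_Ioi.1 h2).le)).1 h1
  exact le_antisymm (le_of_ae_eq_of_left_cont hv.mono hw.mono hv.left_cont hae ht)
    (le_of_ae_eq_of_left_cont hw.mono hv.mono hw.left_cont (hae.mono fun _ => Eq.symm) ht)

theorem IsPC.propagation_eq (h : IsPC k l) {τ : ℝ} (hτ : 0 ≤ τ) {t : ℝ} (ht : 0 < t) :
    propagation k t τ = (subordinator k τ).real (Iio t) :=
  (Classical.epsilon_spec (p := IsPropagation k τ)
    ⟨_, h.isPropagation_subordinator hτ⟩).eq (h.isPropagation_subordinator hτ) ht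

/-! ### The first moment of the inverse subordinator -/

/-- The first moment `∫₀^∞ w(t, τ) dτ` of the inverse subordinator. -/
noncomputable def inverseMoment (k : ℝ → ℝ) (t : ℝ) : ℝ≥0∞ :=
  ∫⁻ τ in Ioi (0 : ℝ), subordinator k (max τ 0) (Iio t)

theorem inverseMoment_mono (k : ℝ → ℝ) : Monotone (inverseMoment k) := fun _ _ hst =>
  lintegral_mono fun _ => measure_mono (Iio_subset_Iio hst)

theorem IsPC.inverseMoment_of_nonpos (h : IsPC k l) {t : ℝ} (ht : t ≤ 0) :
    inverseMoment k t = 0 := by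
  have : ∀ τ, subordinator k (max τ 0) (Iio t) = 0 := fun τ => le_antisymm
    ((measure_mono (Iio_subset_Iio ht)).trans (h.subordinator_spec (le_max_right _ _)).1.le) zero_le
  simp [inverseMoment, this]

/-- A vanishing transform would make the monotone $k$ vanish on $(0,\infty)$, contradicting $k*l=1$.
-/
theorem IsPC.laplace_pos (h : IsPC k l) {lam : ℝ} (hl : 0 < lam) : 0 < laplace k lam := by
  refine lt_of_le_of_ne (laplace_nonneg h.nonneg_k lam) fun h0 => ?_
  have h1 : ∀ᵐ t ∂(volume.restrict (Ioi (0 : ℝ))), k t = 0 := by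
    have h2 := (setIntegral_eq_zero_iff_of_nonneg_ae
      ((ae_restrict_iff' measurableSet_Ioi).2 (ae_of_all _ fun t ht =>
        mul_nonneg (Real.exp_pos (-(lam * t))).le (h.nonneg_k t ht)))
      (h.integrableOn_exp_mul hl)).1 h0.symm
    filter_upwards [h2] with t ht
    simpa [(Real.exp_pos _).ne'] using ht
  have h3 : ∀ t, 0 < t → k t = 0 := by
    intro t ht
    have h2 : ∀ᵐ r ∂(volume.restrict (Ioo 0 t)), k r = 0 :=
      ae_restrict_of_ae_restrict_of_subset (fun r hr => hr.1) h1
    have h3 : (ae (volume.restrict (Ioo 0 t))).NeBot := by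
      rw [ae_neBot, Ne, Measure.restrict_eq_zero]
      simp [ht]
    obtain ⟨r, hr⟩ := (h2.and (ae_restrict_mem measurableSet_Ioo)).exists
    exact le_antisymm (hr.1 ▸ h.anti_k (mem_Ioi.2 hr.2.1) (mem_Ioi.2 ht) hr.2.2.le) (h.nonneg_k t ht)
  have h4 : ∀ t, 0 < t → timeConv k l t = 0 := by
    intro t ht
    rw [timeConv, intervalIntegral.integral_of_le ht.le, integral_Ioc_eq_integral_Ioo]
    refine setIntegral_eq_zero_of_forall_eq_zero fun s hs => ?_
    rw [h3 _ (sub_pos.2 hs.2), zero_mul]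
  have h5 : (ae (volume.restrict (Ioi (0 : ℝ)))).NeBot := by
    rw [ae_neBot, Ne, Measure.restrict_eq_zero]
    simp
  obtain ⟨t, ht⟩ := (h.conv_eq_one.and (ae_restrict_mem measurableSet_Ioi)).exists
  rw [h4 t ht.2] at ht
  exact zero_ne_one ht.1

/-- By Tonelli the $t$-integral is taken first and equals $e^{-\tau\varphi(\lambda)}/\lambda$;
integrating this in $\tau$ is elementary because $\varphi(\lambda)>0$. -/
theorem IsPC.lintegral_exp_mul_inverseMoment (h : IsPC k l) {lam : ℝ} (hl : 0 < lam) :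
    ∫⁻ t in Ioi (0 : ℝ), ENNReal.ofReal (Real.exp (-(lam * t))) * inverseMoment k t =
      ENNReal.ofReal (1 / (lam * (lam * laplace k lam))) := by
  have hφ : 0 < lam * laplace k lam := mul_pos hl (h.laplace_pos hl)
  have hm := h.measurable_subordinator_Iio
  have h1 : ∀ t, ENNReal.ofReal (Real.exp (-(lam * t))) * inverseMoment k t =
      ∫⁻ τ in Ioi (0 : ℝ), ENNReal.ofReal (Real.exp (-(lam * t))) *
        subordinator k (max τ 0) (Iio t) := fun t => by
    rw [inverseMoment, lintegral_const_mul' _ _ ENNReal.ofReal_ne_top]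
  simp_rw [h1]
  rw [lintegral_lintegral_swap]
  · have h2 : ∀ τ, ∫⁻ t in Ioi (0 : ℝ), ENNReal.ofReal (Real.exp (-(lam * t))) *
        subordinator k (max τ 0) (Iio t) =
        ENNReal.ofReal (1 / lam) *
          ENNReal.ofReal (Real.exp (-(max τ 0 * (lam * laplace k lam)))) := fun τ => by
      have := h.isFiniteMeasure_subordinator (le_max_right τ 0)
      have hs := h.subordinator_spec (le_max_right τ 0)
      rw [← hs.2 lam hl, laplaceM_eq_lintegral_measure_Iio _ hs.1 hl, ← mul_assoc,
        ← ENNReal.ofReal_mul (by positivity), one_div_mul_cancel hl.ne', ENNReal.ofReal_one, one_mul]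
    simp_rw [h2]
    rw [lintegral_const_mul' _ _ ENNReal.ofReal_ne_top]
    have h3 : ∫⁻ τ in Ioi (0 : ℝ), ENNReal.ofReal (Real.exp (-(max τ 0 * (lam * laplace k lam)))) =
        ∫⁻ τ in Ioi (0 : ℝ), ENNReal.ofReal (Real.exp (-((lam * laplace k lam) * τ))) := by
      refine setLIntegral_congr_fun measurableSet_Ioi fun τ hτ => ?_
      rw [max_eq_left (mem_Ioi.1 hτ).le, mul_comm τ]
    rw [h3, lintegral_exp_Ioi hφ, ← ENNReal.ofReal_mul (by positivity)]
    congr 1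
    rw [mul_zero, neg_zero, Real.exp_zero]
    field_simp
  · exact ((by fun_prop : Measurable fun p : ℝ × ℝ =>
      ENNReal.ofReal (Real.exp (-(lam * p.1)))).mul hm).aemeasurable

/-- By monotonicity, an infinite value at $t$ would persist on $(t,\infty)$ and make the transform
at $1$ infinite. -/
theorem IsPC.inverseMoment_ne_top (h : IsPC k l) (t : ℝ) : inverseMoment k t ≠ ∞ := by
  intro htop
  have h1 := h.lintegral_exp_mul_inverseMoment one_pos
  have hpos : 0 < t := by
    by_contra hc
    rw [h.inverseMoment_of_nonpos (not_lt.1 hc)] at htop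
    exact ENNReal.zero_ne_top htop
  have h2 : ∫⁻ s in Ioi t, ENNReal.ofReal (Real.exp (-(1 * s))) * inverseMoment k s ≤
      ENNReal.ofReal (1 / (1 * (1 * laplace k 1))) :=
    h1 ▸ lintegral_mono_set (Ioi_subset_Ioi hpos.le)
  have h3 : ∫⁻ s in Ioi t, ENNReal.ofReal (Real.exp (-(1 * s))) * inverseMoment k s = ∞ := by
    have : ∫⁻ s in Ioi t, ENNReal.ofReal (Real.exp (-(1 * s))) * inverseMoment k s =
        ∫⁻ s in Ioi t, ∞ := by
      refine setLIntegral_congr_fun measurableSet_Ioi fun s hs => ?_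
      have : inverseMoment k s = ∞ :=
        top_le_iff.1 (htop ▸ inverseMoment_mono k (mem_Ioi.1 hs).le)
      rw [this, ENNReal.mul_top]
      simp [Real.exp_pos]
    rw [this]; simp
  rw [h3] at h2
  exact absurd h2 (by simp)

/-- The heart of the estimate: on $(0,\delta]$ the integrand is at most $1$, and beyond $\delta$
submultiplicativity extracts the factor $w(t,\delta)$. -/
theorem IsPC.inverseMoment_le (h : IsPC k l) {δ : ℝ} (hδ : 0 ≤ δ) (t : ℝ) :
    inverseMoment k t ≤ ENNReal.ofReal δ + subordinator k δ (Iio t) * inverseMoment k t := by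
  have hm : Measurable fun τ => subordinator k (max τ 0) (Iio t) := by
    have hm' := h.measurable_subordinator_Iio.comp (measurable_prodMk_left (x := t))
    exact hm'
  have h0 : inverseMoment k t = (∫⁻ τ in Ioc 0 δ, subordinator k (max τ 0) (Iio t)) +
      ∫⁻ τ in Ioi δ, subordinator k (max τ 0) (Iio t) := by
    rw [inverseMoment, ← Ioc_union_Ioi_eq_Ioi hδ,
      lintegral_union measurableSet_Ioi (Ioc_disjoint_Ioi le_rfl)]
  refine h0.trans_le (add_le_add ?_ ?_)
  · refine (setLIntegral_mono' (g := fun _ => 1) measurableSet_Ioc fun τ _ =>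
      h.subordinator_le_one (le_max_right τ 0) _).trans ?_
    rw [setLIntegral_one, Real.volume_Ioc, sub_zero]
  · have h1 : ∫⁻ τ in Ioi δ, subordinator k (max τ 0) (Iio t) =
        ∫⁻ τ in Ioi 0, subordinator k (max (τ + δ) 0) (Iio t) := by
      have h2 := (measurePreserving_add_right (volume : Measure ℝ) δ).setLIntegral_comp_preimage_emb
        (MeasurableEquiv.addRight δ).measurableEmbedding
        (fun τ => subordinator k (max τ 0) (Iio t)) (Ioi δ)
      rw [← h2]
      congr 2
      ext x; simp
    rw [h1, inverseMoment, ← lintegral_const_mul _ hm]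
    refine setLIntegral_mono' measurableSet_Ioi fun τ hτ => ?_
    have hτ' : 0 ≤ τ := (mem_Ioi.1 hτ).le
    rw [max_eq_left (add_nonneg hτ' hδ), max_eq_left hτ', add_comm]
    exact h.subordinator_Iio_add_le hδ hτ' t

/-- Otherwise every law with $\tau>0$ lives on $[t,\infty)$, so its transform at $1$ is at most
$e^{-t}<1$; but that transform tends to $1$ as $\tau\downarrow0$. -/
theorem IsPC.inverseMoment_pos (h : IsPC k l) {t : ℝ} (ht : 0 < t) : 0 < inverseMoment k t := by
  refine pos_iff_ne_zero.2 fun h0 => ?_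
  have hw : ∀ τ, 0 < τ → subordinator k τ (Iio t) = 0 := by
    intro τ hτ
    have h1 := (h.subordinator_spec hτ.le)
    by_contra hne
    have h2 : ∫⁻ s in Ioc 0 τ, subordinator k τ (Iio t) ≤ inverseMoment k t := by
      refine (setLIntegral_mono' measurableSet_Ioc fun s hs => ?_).trans
        (lintegral_mono_set (Ioc_subset_Ioi_self))
      rw [max_eq_left hs.1.le]
      exact h.subordinator_Iio_anti t (mem_Ici.2 hs.1.le) (mem_Ici.2 hτ.le) hs.2
    rw [h0] at h2
    simp [hne] at h2
    linarith
  have h2 : ∀ τ, 0 < τ → Real.exp (-(τ * (1 * laplace k 1))) ≤ Real.exp (-(1 * t)) := by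
    intro τ hτ
    have hs := h.subordinator_spec hτ.le
    have h3 : laplaceM (subordinator k τ) 1 ≤ ENNReal.ofReal (Real.exp (-(1 * t))) := by
      have hae : ∀ᵐ x ∂(subordinator k τ), t ≤ x := by
        rw [ae_iff]; simpa [← Iio_def] using hw τ hτ
      calc laplaceM (subordinator k τ) 1
          ≤ ∫⁻ x, ENNReal.ofReal (Real.exp (-(1 * t))) ∂(subordinator k τ) := by
            refine lintegral_mono_ae (hae.mono fun x hx => ?_)
            gcongr
        _ ≤ ENNReal.ofReal (Real.exp (-(1 * t))) := by
            rw [lintegral_const]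
            exact mul_le_of_le_one_right' (h.subordinator_univ_le hτ.le)
    rw [hs.2 1 one_pos] at h3
    exact (ENNReal.ofReal_le_ofReal_iff (Real.exp_pos _).le).1 h3
  have h4 : Tendsto (fun τ => Real.exp (-(τ * (1 * laplace k 1)))) (𝓝[>] 0) (𝓝 1) := by
    have : Tendsto (fun τ => Real.exp (-(τ * (1 * laplace k 1)))) (𝓝 0)
        (𝓝 (Real.exp (-(0 * (1 * laplace k 1))))) :=
      (by fun_prop : Continuous fun τ : ℝ => Real.exp (-(τ * (1 * laplace k 1)))).tendsto 0
    simpa using this.mono_left nhdsWithin_le_nhds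
  have h5 : (1 : ℝ) ≤ Real.exp (-(1 * t)) := by
    refine le_of_tendsto h4 ?_
    filter_upwards [self_mem_nhdsWithin] with τ hτ using h2 τ hτ
  rw [Real.one_le_exp_iff] at h5
  linarith

end

/-! ### Identification of $1*l$ with the first moment -/

theorem lconvolution_congr_left {f g h : ℝ → ℝ≥0∞} (hfg : f =ᵐ[volume] g) :
    lconvolution f h volume = lconvolution g h volume := by
  ext x
  exact lintegral_congr_ae (hfg.mono fun y hy => by simp only [hy])

theorem lconvolution_congr_right {f g h : ℝ → ℝ≥0∞} (hfg : f =ᵐ[volume] g) :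
    lconvolution h f volume = lconvolution h g volume := by
  rw [lconvolution_comm, lconvolution_congr_left hfg, lconvolution_comm]

theorem lconvolution_add_left {f g h : ℝ → ℝ≥0∞} (hf : AEMeasurable f) (hh : AEMeasurable h) :
    lconvolution (f + g) h volume = lconvolution f h volume + lconvolution g h volume := by
  ext x
  simp only [lconvolution_def, Pi.add_apply, add_mul]
  rw [lintegral_add_left']
  exact hf.mul (by fun_prop)

theorem lconvolution_heaviside (f : ℝ → ℝ≥0∞) (t : ℝ) :
    lconvolution f ((Ioi 0).indicator 1) volume t = ∫⁻ y in Iio t, f y := by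
  rw [lconvolution_def, ← lintegral_indicator measurableSet_Iio]
  refine lintegral_congr fun y => ?_
  simp only [indicator, mem_Ioi, mem_Iio, Pi.one_apply]
  split_ifs <;> first | (exfalso; linarith) | simp

theorem laplaceM_withDensity {f : ℝ → ℝ≥0∞} (hf : AEMeasurable f) (lam : ℝ) :
    laplaceM (volume.withDensity f) lam =
      ∫⁻ t, ENNReal.ofReal (Real.exp (-(lam * t))) * f t := by
  rw [laplaceM, lintegral_withDensity_eq_lintegral_mul₀ hf (by fun_prop)]
  exact lintegral_congr fun t => mul_comm (f t) _

theorem laplaceM_withDensity_indicator {f : ℝ → ℝ≥0∞}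
    (hf : AEMeasurable ((Ioi 0).indicator f)) (lam : ℝ) :
    laplaceM (volume.withDensity ((Ioi 0).indicator f)) lam =
      ∫⁻ t in Ioi (0 : ℝ), ENNReal.ofReal (Real.exp (-(lam * t))) * f t := by
  rw [laplaceM_withDensity hf, ← lintegral_indicator measurableSet_Ioi]
  refine lintegral_congr fun y => ?_
  simp only [indicator]
  split_ifs <;> simp

/-- Two nondecreasing functions with the same primitive interlace. -/
theorem le_of_lintegral_Iio_eq {F G : ℝ → ℝ≥0∞} (hF : Monotone F) (hG : Monotone G)
    (hfin : ∀ t, ∫⁻ s in Iio t, F s ≠ ∞) (h : ∀ t, ∫⁻ s in Iio t, F s = ∫⁻ s in Iio t, G s)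
    {a b : ℝ} (hab : a < b) : F a ≤ G b := by
  have hsplit : ∀ f : ℝ → ℝ≥0∞, ∫⁻ s in Iio b, f s = (∫⁻ s in Iio a, f s) + ∫⁻ s in Ico a b, f s := by
    intro f
    rw [← Iio_union_Ico_eq_Iio hab.le, lintegral_union measurableSet_Ico]
    rw [disjoint_left]
    intro x hx hx'
    exact absurd hx'.1 (not_le.2 hx)
  have h1 : ∫⁻ s in Ico a b, F s = ∫⁻ s in Ico a b, G s := by
    have := h b
    rw [hsplit F, hsplit G, ← h a] at this
    exact (ENNReal.add_right_inj (hfin a)).1 this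
  have h2 : F a * ENNReal.ofReal (b - a) ≤ G b * ENNReal.ofReal (b - a) := by
    calc F a * ENNReal.ofReal (b - a) = ∫⁻ s in Ico a b, F a := by simp
      _ ≤ ∫⁻ s in Ico a b, F s := setLIntegral_mono' measurableSet_Ico fun s hs => hF hs.1
      _ = ∫⁻ s in Ico a b, G s := h1
      _ ≤ ∫⁻ s in Ico a b, G b := setLIntegral_mono' measurableSet_Ico fun s hs => hG hs.2.le
      _ = _ := by simp
  exact (ENNReal.mul_le_mul_iff_left (by simpa using hab) ENNReal.ofReal_ne_top).1 h2

section

variable {k l : ℝ → ℝ}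

theorem IsPC.aemeasurable_k (h : IsPC k l) :
    AEMeasurable ((Ioi 0).indicator fun t => ENNReal.ofReal (k t)) :=
  (aemeasurable_indicator_iff measurableSet_Ioi).2
    (aemeasurable_restrict_of_antitoneOn measurableSet_Ioi h.anti_k).ennreal_ofReal

theorem IsPC.aestronglyMeasurable_l (h : IsPC k l) :
    AEStronglyMeasurable l (volume.restrict (Ioi 0)) :=
  h.locInt_l.aestronglyMeasurable.mono_set Ioi_subset_Ici_self

theorem IsPC.aemeasurable_l (h : IsPC k l) :
    AEMeasurable ((Ioi 0).indicator fun t => ENNReal.ofReal (l t)) :=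
  (aemeasurable_indicator_iff measurableSet_Ioi).2 h.aestronglyMeasurable_l.aemeasurable.ennreal_ofReal

theorem IsPC.aemeasurable_neg_l (h : IsPC k l) :
    AEMeasurable ((Ioi 0).indicator fun t => ENNReal.ofReal (-l t)) :=
  (aemeasurable_indicator_iff measurableSet_Ioi).2
    h.aestronglyMeasurable_l.aemeasurable.neg.ennreal_ofReal

/-- Both sides have the transform $\hat k(\lambda)\cdot1/(\lambda^2\hat k(\lambda))=\lambda^{-2}$.
-/
theorem IsPC.lconvolution_k_inverseMoment (h : IsPC k l) :
    lconvolution ((Ioi 0).indicator fun t => ENNReal.ofReal (k t)) (inverseMoment k) volume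
      =ᵐ[volume] lconvolution ((Ioi 0).indicator 1) ((Ioi 0).indicator 1) volume := by
  have hM : Measurable (inverseMoment k) := (inverseMoment_mono k).measurable
  have hMind : (Ioi 0).indicator (inverseMoment k) = inverseMoment k := by
    ext t
    by_cases ht : 0 < t
    · simp [ht]
    · simp [ht, h.inverseMoment_of_nonpos (not_lt.1 ht)]
  have hH : Measurable ((Ioi (0 : ℝ)).indicator (1 : ℝ → ℝ≥0∞)) :=
    measurable_one.indicator measurableSet_Ioi
  have hnull : ∀ f : ℝ → ℝ≥0∞, (volume.withDensity ((Ioi 0).indicator f)) (Iio 0) = 0 := by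
    intro f
    rw [withDensity_apply _ measurableSet_Iio]
    refine setLIntegral_eq_zero measurableSet_Iio fun x hx => ?_
    simp [not_lt.2 (mem_Iio.1 hx).le]
  have hL1 : ∀ lam, 0 < lam → laplaceM (volume.withDensity (inverseMoment k)) lam =
      ENNReal.ofReal (1 / (lam * (lam * laplace k lam))) := fun lam hl => by
    rw [← hMind, laplaceM_withDensity_indicator (by rw [hMind]; exact hM.aemeasurable),
      h.lintegral_exp_mul_inverseMoment hl]
  have hL2 : ∀ lam, 0 < lam → laplaceM (volume.withDensity
      ((Ioi 0).indicator fun t => ENNReal.ofReal (k t))) lam = ENNReal.ofReal (laplace k lam) :=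
    fun lam hl => by
      rw [laplaceM_withDensity_indicator h.aemeasurable_k,
        ofReal_laplace h.nonneg_k (h.integrableOn_exp_mul hl)]
  have hL3 : ∀ lam, 0 < lam → laplaceM (volume.withDensity
      ((Ioi (0 : ℝ)).indicator 1)) lam = ENNReal.ofReal (1 / lam) := fun lam hl => by
    rw [laplaceM_withDensity_indicator hH.aemeasurable]
    simp only [Pi.one_apply, mul_one]
    rw [lintegral_exp_Ioi hl]
    simp
  have hK := h.aemeasurable_k
  rw [← withDensity_eq_iff_of_sigmaFinite (aemeasurable_lconvolution hK hM.aemeasurable)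
    (aemeasurable_lconvolution hH.aemeasurable hH.aemeasurable)]
  have e1 : volume.withDensity (lconvolution ((Ioi 0).indicator fun t => ENNReal.ofReal (k t))
      (inverseMoment k) volume) = (volume.withDensity
      ((Ioi 0).indicator fun t => ENNReal.ofReal (k t))).conv
      (volume.withDensity (inverseMoment k)) :=
    (conv_withDensity_eq_mlconvolution₀ hK hM.aemeasurable).symm
  have e2 : volume.withDensity (lconvolution ((Ioi (0 : ℝ)).indicator (1 : ℝ → ℝ≥0∞))
      ((Ioi 0).indicator 1) volume) = (volume.withDensity ((Ioi 0).indicator 1)).conv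
      (volume.withDensity ((Ioi 0).indicator 1)) :=
    (conv_withDensity_eq_lconvolution hH hH).symm
  have hMn : (volume.withDensity (inverseMoment k)) (Iio 0) = 0 := hMind ▸ hnull _
  rw [e1, e2]
  have hval : ∀ lam, 0 < lam → laplaceM (volume.withDensity
      ((Ioi 0).indicator fun t => ENNReal.ofReal (k t))) lam *
      laplaceM (volume.withDensity (inverseMoment k)) lam =
      ENNReal.ofReal (1 / lam) * ENNReal.ofReal (1 / lam) := fun lam hl => by
    have := h.laplace_pos hl
    rw [hL1 lam hl, hL2 lam hl, ← ENNReal.ofReal_mul this.le, ← ENNReal.ofReal_mul (by positivity)]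
    congr 1; field_simp
  refine laplaceM_ext (le_antisymm ((conv_Iio_le (hnull _) hMn 0).trans (by simp [hMn])) zero_le)
    (le_antisymm ((conv_Iio_le (hnull _) (hnull _) 0).trans (by rw [hnull, zero_mul])) zero_le)
    ?_ fun lam hl => ?_
  · rw [laplaceM_conv, hval 1 one_pos]
    exact ENNReal.mul_ne_top ENNReal.ofReal_ne_top ENNReal.ofReal_ne_top
  · rw [laplaceM_conv, laplaceM_conv, hL3 lam hl, hval lam hl]

/-- The relation $k*l=1$ with the negative part of $l$ moved across, so that all terms lie in
$[0,\infty]$ and convolution may be reassociated freely, although $l$ is allowed to change sign. -/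
theorem IsPC.lconvolution_l_k (h : IsPC k l) :
    lconvolution ((Ioi 0).indicator fun t => ENNReal.ofReal (l t))
      ((Ioi 0).indicator fun t => ENNReal.ofReal (k t)) volume =ᵐ[volume]
    lconvolution ((Ioi 0).indicator fun t => ENNReal.ofReal (-l t))
      ((Ioi 0).indicator fun t => ENNReal.ofReal (k t)) volume + (Ioi 0).indicator 1 := by
  have hconv : ∀ (f : ℝ → ℝ) (t : ℝ), lconvolution ((Ioi 0).indicator fun t => ENNReal.ofReal (f t))
      ((Ioi 0).indicator fun t => ENNReal.ofReal (k t)) volume t =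
      ∫⁻ s in Ioo 0 t, ENNReal.ofReal (k (t - s) * f s) := by
    intro f t
    rw [lconvolution_def, ← lintegral_indicator measurableSet_Ioo]
    refine lintegral_congr fun s => ?_
    simp only [indicator, mem_Ioi, mem_Ioo]
    rw [neg_add_eq_sub]
    by_cases h1 : 0 < s
    · by_cases h2 : s < t
      · rw [if_pos h1, if_pos (sub_pos.2 h2), if_pos ⟨h1, h2⟩,
          ENNReal.ofReal_mul (h.nonneg_k _ (sub_pos.2 h2)), mul_comm]
      · rw [if_neg (by linarith : ¬ 0 < t - s), mul_zero, if_neg (fun hc : 0 < s ∧ s < t => h2 hc.2)]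
    · rw [if_neg h1, zero_mul, if_neg (fun hc : 0 < s ∧ s < t => h1 hc.1)]
  have hc := (ae_restrict_iff' measurableSet_Ioi).1 h.conv_eq_one
  filter_upwards [hc] with t ht
  rw [Pi.add_apply, hconv, hconv]
  by_cases h0 : 0 < t
  · have h1 := ht h0
    rw [timeConv, intervalIntegral.integral_of_le h0.le, integral_Ioc_eq_integral_Ioo] at h1
    have hi : IntegrableOn (fun s => k (t - s) * l s) (Ioo 0 t) := by
      by_contra hc
      rw [integral_undef hc] at h1
      exact zero_ne_one h1
    rw [integral_eq_lintegral_pos_part_sub_lintegral_neg_part hi] at h1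
    have f1 : ∫⁻ s in Ioo 0 t, ENNReal.ofReal (k (t - s) * l s) ≠ ∞ := by
      simpa using hi.lintegral_lt_top.ne
    have f2 : ∫⁻ s in Ioo 0 t, ENNReal.ofReal (-(k (t - s) * l s)) ≠ ∞ := by
      simpa using hi.neg.lintegral_lt_top.ne
    simp only [mul_neg, indicator_of_mem (mem_Ioi.2 h0), Pi.one_apply]
    rw [← ENNReal.toReal_eq_toReal_iff' f1 (by finiteness), ENNReal.toReal_add f2 (by simp)]
    simp only [ENNReal.toReal_one]
    linarith
  · simp [h0]

theorem lintegral_Iio_indicator (f : ℝ → ℝ≥0∞) (t : ℝ) :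
    ∫⁻ s in Iio t, (Ioi 0).indicator f s = ∫⁻ s in Ioo 0 t, f s := by
  rw [setLIntegral_indicator measurableSet_Ioi]; rfl

theorem IsPC.integrableOn_l (h : IsPC k l) (t : ℝ) : IntegrableOn l (Ioo 0 t) :=
  (h.locInt_l.integrableOn_compact_subset Icc_subset_Ici_self isCompact_Icc).mono_set
    Ioo_subset_Icc_self

/-- `1 ∗ l` is the first moment of the inverse subordinator. -/
theorem IsPC.lintegral_l (h : IsPC k l) (t : ℝ) :
    ∫⁻ s in Ioo 0 t, ENNReal.ofReal (l s) =
      (∫⁻ s in Ioo 0 t, ENNReal.ofReal (-l s)) + inverseMoment k t := by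
  have hM : Measurable (inverseMoment k) := (inverseMoment_mono k).measurable
  have hH : Measurable ((Ioi (0 : ℝ)).indicator (1 : ℝ → ℝ≥0∞)) :=
    measurable_one.indicator measurableSet_Ioi
  set H : ℝ → ℝ≥0∞ := (Ioi (0 : ℝ)).indicator 1 with hHdef
  set Lp : ℝ → ℝ≥0∞ := (Ioi (0 : ℝ)).indicator fun t => ENNReal.ofReal (l t) with hLp
  set Lm : ℝ → ℝ≥0∞ := (Ioi (0 : ℝ)).indicator fun t => ENNReal.ofReal (-l t) with hLm
  set K : ℝ → ℝ≥0∞ := (Ioi (0 : ℝ)).indicator fun t => ENNReal.ofReal (k t) with hK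
  have mLp : AEMeasurable Lp := h.aemeasurable_l
  have mLm : AEMeasurable Lm := h.aemeasurable_neg_l
  have mK : AEMeasurable K := h.aemeasurable_k
  have key : lconvolution (lconvolution Lp H volume) H volume =
      lconvolution (lconvolution Lm H volume) H volume + lconvolution (inverseMoment k) H volume := by
    -- Replacing $1*1$ by $k*M$ brings $L*k$ into play, to which the PC relation applies.
    have hA : ∀ L : ℝ → ℝ≥0∞, AEMeasurable L → lconvolution (lconvolution L H volume) H volume =
        lconvolution (lconvolution L K volume) (inverseMoment k) volume := fun L hL => by
      rw [← lconvolution_assoc₀ hL hH.aemeasurable hH.aemeasurable,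
        ← lconvolution_assoc₀ hL mK hM.aemeasurable,
        lconvolution_congr_right h.lconvolution_k_inverseMoment]
    rw [hA Lp mLp, hA Lm mLm, lconvolution_congr_left h.lconvolution_l_k,
      lconvolution_add_left (aemeasurable_lconvolution mLm mK) hM.aemeasurable, lconvolution_comm (f := H)]
  set Ap : ℝ → ℝ≥0∞ := fun t => ∫⁻ s in Ioo 0 t, ENNReal.ofReal (l s) with hAp
  set Am : ℝ → ℝ≥0∞ := fun t => ∫⁻ s in Ioo 0 t, ENNReal.ofReal (-l s) with hAm
  have eAp : lconvolution Lp H volume = Ap := by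
    ext t; rw [lconvolution_heaviside, lintegral_Iio_indicator]
  have eAm : lconvolution Lm H volume = Am := by
    ext t; rw [lconvolution_heaviside, lintegral_Iio_indicator]
  rw [eAp, eAm] at key
  have monoAp : Monotone Ap := fun a b hab => lintegral_mono_set (Ioo_subset_Ioo_right hab)
  have monoAm : Monotone Am := fun a b hab => lintegral_mono_set (Ioo_subset_Ioo_right hab)
  have finAp : ∀ t, Ap t ≠ ∞ := fun t => (h.integrableOn_l t).lintegral_lt_top.ne
  have finAm : ∀ t, Am t ≠ ∞ := fun t => (h.integrableOn_l t).neg.lintegral_lt_top.ne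
  have key' : ∀ t, ∫⁻ s in Iio t, Ap s = ∫⁻ s in Iio t, (Am + inverseMoment k) s := by
    intro t
    have := congrFun key t
    rw [Pi.add_apply, lconvolution_heaviside, lconvolution_heaviside, lconvolution_heaviside] at this
    rw [this]
    simp only [Pi.add_apply]
    rw [lintegral_add_left monoAm.measurable]
  have fin1 : ∀ t, ∫⁻ s in Iio t, Ap s ≠ ∞ := by
    intro t
    have e : Ap = (Ioi 0).indicator Ap := by
      ext s
      by_cases hs : 0 < s
      · simp [hs]
      · simp [hs, hAp]
    rw [e, lintegral_Iio_indicator]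
    refine ne_top_of_le_ne_top (b := ∫⁻ s in Ioo 0 t, Ap t) ?_
      (setLIntegral_mono' measurableSet_Ioo fun s hs => monoAp hs.2.le)
    rw [setLIntegral_const]
    exact ENNReal.mul_ne_top (finAp t) (by simp)
  have monoG : Monotone (Am + inverseMoment k) := monoAm.add (inverseMoment_mono k)
  -- The once-integrated identity only interlaces the two monotone functions. Continuity of `Ap`
  -- closes the gap from both sides, so continuity of the first moment need not be known beforehand.
  have cont : ∀ f : ℝ → ℝ, (∀ t, IntegrableOn f (Ioo 0 t)) →
      Continuous fun t => ∫⁻ s in Ioo 0 t, ENNReal.ofReal (f s) := by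
    intro f hf
    have hf' : ∀ t, IntegrableOn (fun s => max (f s) 0) (Ioo 0 t) := fun t => (hf t).pos_part
    have e : (fun t => ∫⁻ s in Ioo 0 t, ENNReal.ofReal (f s)) = fun t =>
        ENNReal.ofReal (∫ s in (0 : ℝ)..t, (Ioi 0).indicator (fun s => max (f s) 0) s) := by
      ext t
      rcases le_or_gt t 0 with ht | ht
      · have h1 : Ioo 0 t = ∅ := Ioo_eq_empty (not_lt.2 ht)
        rw [h1, intervalIntegral.integral_of_ge ht]
        rw [setIntegral_eq_zero_of_forall_eq_zero fun s hs => by simp [hs.2]]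
        simp
      · rw [intervalIntegral.integral_of_le ht.le, integral_Ioc_eq_integral_Ioo,
          setIntegral_congr_fun (g := fun s => max (f s) 0) measurableSet_Ioo fun s hs => by
            simp [hs.1],
          ofReal_integral_eq_lintegral_ofReal (hf' t) (ae_of_all _ fun s => le_max_right _ _)]
        refine lintegral_congr fun s => ?_
        rcases le_total (f s) 0 with h1 | h1
        · simp [h1, ENNReal.ofReal_of_nonpos h1]
        · simp [h1]
    rw [e]
    refine ENNReal.continuous_ofReal.comp (intervalIntegral.continuous_primitive (fun a b => ?_) 0)
    have : IntegrableOn ((Ioi 0).indicator (fun s => max (f s) 0)) (Iio (max a b + 1)) := by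
      rw [IntegrableOn, integrable_indicator_iff measurableSet_Ioi, IntegrableOn,
        Measure.restrict_restrict measurableSet_Ioi]
      exact hf' _
    refine (this.mono_set fun x hx => ?_).intervalIntegrable
    rcases hx with ⟨_, hx⟩
    exact lt_of_le_of_lt hx (lt_add_one _)
  have contAp : Continuous Ap := cont l h.integrableOn_l
  have contAm : Continuous Am := cont (fun s => -l s) fun t => (h.integrableOn_l t).neg
  have le1 : Ap t ≤ (Am + inverseMoment k) t := by
    refine le_of_tendsto (contAp.continuousAt.tendsto.mono_left
      (nhdsWithin_le_nhds (s := Iio t))) ?_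
    filter_upwards [self_mem_nhdsWithin] with s hs
    exact le_of_lintegral_Iio_eq monoAp monoG fin1 key' hs
  have le2 : (Am + inverseMoment k) t ≤ Ap t := by
    refine ge_of_tendsto (contAp.continuousAt.tendsto.mono_left
      (nhdsWithin_le_nhds (s := Ioi t))) ?_
    filter_upwards [self_mem_nhdsWithin] with s hs
    exact le_of_lintegral_Iio_eq monoG monoAp (fun t => key' t ▸ fin1 t) (fun t => (key' t).symm) hs
  exact le_antisymm le1 le2

theorem IsPC.timeConv_one (h : IsPC k l) {t : ℝ} (ht : 0 < t) :
    timeConv (fun _ => 1) l t = (inverseMoment k t).toReal := by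
  have h1 := congrArg ENNReal.toReal (h.lintegral_l t)
  have h2 : ∫⁻ s in Ioo 0 t, ENNReal.ofReal (-l s) ≠ ∞ :=
    (h.integrableOn_l t).neg.lintegral_lt_top.ne
  rw [ENNReal.toReal_add h2 (h.inverseMoment_ne_top t)] at h1
  simp only [timeConv, one_mul]
  rw [intervalIntegral.integral_of_le ht.le, integral_Ioc_eq_integral_Ioo,
    integral_eq_lintegral_pos_part_sub_lintegral_neg_part (h.integrableOn_l t), h1]
  ring

end

/-! ### Negative moments from mass bounds near zero -/

theorem lintegral_Ioi_rpow {a c : ℝ} (ha : a < -1) (hc : 0 < c) :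
    ∫⁻ s in Ioi c, ENNReal.ofReal (s ^ a) = ENNReal.ofReal (-c ^ (a + 1) / (a + 1)) := by
  rw [← integral_Ioi_rpow_of_lt ha hc,
    ofReal_integral_eq_lintegral_ofReal (integrableOn_Ioi_rpow_of_lt ha hc)]
  filter_upwards [ae_restrict_mem measurableSet_Ioi] with s hs
  exact Real.rpow_nonneg (hc.trans hs).le _

theorem lintegral_Ioc_rpow {a c : ℝ} (ha : -1 < a) (hc : 0 < c) :
    ∫⁻ s in Ioc 0 c, ENNReal.ofReal (s ^ a) = ENNReal.ofReal (c ^ (a + 1) / (a + 1)) := by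
  have h1 := integral_rpow (a := 0) (b := c) (Or.inl ha)
  rw [Real.zero_rpow (by linarith), sub_zero, intervalIntegral.integral_of_le hc.le] at h1
  rw [← h1, ofReal_integral_eq_lintegral_ofReal
    ((intervalIntegrable_iff_integrableOn_Ioc_of_le hc.le).1
      (intervalIntegral.intervalIntegrable_rpow' ha))]
  filter_upwards [ae_restrict_mem measurableSet_Ioc] with s hs
  exact Real.rpow_nonneg hs.1.le _

/-- Layer-cake formula for a negative power. -/
theorem lintegral_rpow_neg_eq (μ : Measure ℝ) [SFinite μ] {α a : ℝ} (hα : 0 < α) (ha : 0 ≤ a) :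
    ∫⁻ τ in Ioi a, ENNReal.ofReal (τ ^ (-α)) ∂μ =
      ∫⁻ s in Ioi a, ENNReal.ofReal (α * s ^ (-α - 1)) * μ (Ioo a s) := by
  have h1 : ∀ τ ∈ Ioi a, ENNReal.ofReal (τ ^ (-α)) =
      ∫⁻ s in Ioi a, ENNReal.ofReal (α * s ^ (-α - 1)) * (Ioi τ).indicator 1 s := by
    intro τ hτ
    have hτ0 : 0 < τ := ha.trans_lt hτ
    have h2 : ∫⁻ s in Ioi a, ENNReal.ofReal (α * s ^ (-α - 1)) * (Ioi τ).indicator 1 s =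
        ∫⁻ s in Ioi τ, ENNReal.ofReal (α * s ^ (-α - 1)) := by
      rw [← lintegral_indicator measurableSet_Ioi, ← lintegral_indicator measurableSet_Ioi]
      refine lintegral_congr fun s => ?_
      simp only [indicator, mem_Ioi, Pi.one_apply]
      have := mem_Ioi.1 hτ
      split_ifs <;> first | (exfalso; linarith) | simp
    simp_rw [h2, ENNReal.ofReal_mul hα.le]
    rw [lintegral_const_mul' _ _ ENNReal.ofReal_ne_top, lintegral_Ioi_rpow (by linarith) hτ0,
      ← ENNReal.ofReal_mul hα.le]
    congr 1
    rw [sub_add_cancel]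
    field_simp
  rw [setLIntegral_congr_fun measurableSet_Ioi h1, lintegral_lintegral_swap]
  · refine setLIntegral_congr_fun measurableSet_Ioi fun s _ => ?_
    rw [lintegral_const_mul' _ _ ENNReal.ofReal_ne_top]
    congr 1
    have h3 : ∀ τ, (Ioi τ).indicator (1 : ℝ → ℝ≥0∞) s = (Iio s).indicator 1 τ := fun τ => by
      simp [indicator]
    simp_rw [h3]
    rw [lintegral_indicator_one measurableSet_Iio, Measure.restrict_apply measurableSet_Iio,
      Iio_inter_Ioi]
  · have : (fun p : ℝ × ℝ => (Ioi p.1).indicator (1 : ℝ → ℝ≥0∞) p.2) =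
        {p : ℝ × ℝ | p.1 < p.2}.indicator 1 := by
      ext p; simp [indicator]
    have hm : Measurable fun p : ℝ × ℝ => (Ioi p.1).indicator (1 : ℝ → ℝ≥0∞) p.2 := by
      rw [this]
      exact measurable_one.indicator (measurableSet_lt measurable_fst measurable_snd)
    exact ((by fun_prop : Measurable fun p : ℝ × ℝ =>
      ENNReal.ofReal (α * p.2 ^ (-α - 1))).mul hm).aemeasurable

/-- The layer-cake integral is split at $s=m$, where the bounds $\delta/m$ and $1$ cross. The first
piece converges at $0$ exactly because $\alpha<1$. -/
theorem lintegral_rpow_neg_le {μ : Measure ℝ} [SFinite μ] {m : ℝ} (hm : 0 < m)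
    (h1 : ∀ δ, 0 < δ → μ (Ioc 0 δ) ≤ 1)
    (hδ : ∀ δ, 0 < δ → μ (Ioc 0 δ) ≤ ENNReal.ofReal (δ / m)) {α : ℝ} (h0 : 0 < α) (hα : α < 1) :
    ∫⁻ τ in Ioi 0, ENNReal.ofReal (τ ^ (-α)) ∂μ ≤ ENNReal.ofReal (1 / (1 - α) * m ^ (-α)) := by
  rw [lintegral_rpow_neg_eq μ h0 le_rfl, ← Ioc_union_Ioi_eq_Ioi hm.le,
    lintegral_union measurableSet_Ioi (Ioc_disjoint_Ioi le_rfl)]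
  have e1 : ∫⁻ s in Ioc 0 m, ENNReal.ofReal (α * s ^ (-α - 1)) * μ (Ioo 0 s) ≤
      ENNReal.ofReal (α / m * (m ^ (-α + 1) / (-α + 1))) := by
    rw [ENNReal.ofReal_mul (by positivity), ← lintegral_Ioc_rpow (by linarith) hm,
      ← lintegral_const_mul' _ _ ENNReal.ofReal_ne_top]
    refine setLIntegral_mono' measurableSet_Ioc fun s hs => ?_
    refine (mul_le_mul_right ((measure_mono Ioo_subset_Ioc_self).trans (hδ s hs.1)) _).trans ?_
    rw [← ENNReal.ofReal_mul (mul_nonneg h0.le (Real.rpow_nonneg hs.1.le _)),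
      ← ENNReal.ofReal_mul (by positivity)]
    refine ENNReal.ofReal_le_ofReal (le_of_eq ?_)
    rw [Real.rpow_sub_one hs.1.ne']
    have := hs.1.ne'
    field_simp
  have e2 : ∫⁻ s in Ioi m, ENNReal.ofReal (α * s ^ (-α - 1)) * μ (Ioo 0 s) ≤
      ENNReal.ofReal (m ^ (-α)) := by
    have : ENNReal.ofReal (m ^ (-α)) = ENNReal.ofReal α *
        ∫⁻ s in Ioi m, ENNReal.ofReal (s ^ (-α - 1)) := by
      rw [lintegral_Ioi_rpow (by linarith) hm, ← ENNReal.ofReal_mul h0.le, sub_add_cancel]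
      congr 1; field_simp
    rw [this, ← lintegral_const_mul' _ _ ENNReal.ofReal_ne_top]
    refine setLIntegral_mono' measurableSet_Ioi fun s hs => ?_
    rw [← ENNReal.ofReal_mul h0.le]
    exact mul_le_of_le_one_right' ((measure_mono Ioo_subset_Ioc_self).trans (h1 s (hm.trans hs)))
  refine (add_le_add e1 e2).trans ?_
  have hα' : 0 < 1 - α := by linarith
  have hα'' : 0 < -α + 1 := by linarith
  rw [← ENNReal.ofReal_add (by positivity) (by positivity)]
  refine ENNReal.ofReal_le_ofReal (le_of_eq ?_)
  rw [Real.rpow_add_one hm.ne', show -α + 1 = 1 - α by ring]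
  field_simp
  ring

/-- Only the linear mass bound is used. The cap covers $(0,1]$, and on $(1,\infty)$ the layer-cake
integrand is at most $\beta s^{-\beta}/m$, integrable because $\beta>1$. -/
theorem lintegral_min_rpow_neg_le {μ : Measure ℝ} [SFinite μ] {m : ℝ} (hm : 0 < m)
    (hδ : ∀ δ, 0 < δ → μ (Ioc 0 δ) ≤ ENNReal.ofReal (δ / m)) {β : ℝ} (hβ : 1 < β) :
    ∫⁻ τ in Ioi 0, min 1 (ENNReal.ofReal (τ ^ (-β))) ∂μ ≤
      ENNReal.ofReal ((1 + β / (β - 1)) / m) := by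
  have hβ0 : 0 < β := by linarith
  have hβ1 : 0 < β - 1 := by linarith
  rw [← Ioc_union_Ioi_eq_Ioi (zero_le_one (α := ℝ)),
    lintegral_union measurableSet_Ioi (Ioc_disjoint_Ioi le_rfl)]
  have e1 : ∫⁻ τ in Ioc 0 1, min 1 (ENNReal.ofReal (τ ^ (-β))) ∂μ ≤ ENNReal.ofReal (1 / m) := by
    refine (lintegral_mono (g := fun _ => 1) fun τ => min_le_left _ _).trans ?_
    rw [setLIntegral_one]
    exact hδ 1 one_pos
  have e2 : ∫⁻ τ in Ioi 1, min 1 (ENNReal.ofReal (τ ^ (-β))) ∂μ ≤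
      ENNReal.ofReal (β / m * (1 / (β - 1))) := by
    refine (lintegral_mono fun τ => min_le_right _ _).trans ?_
    rw [lintegral_rpow_neg_eq μ hβ0 zero_le_one]
    have : ENNReal.ofReal (1 / (β - 1)) = ∫⁻ s in Ioi 1, ENNReal.ofReal (s ^ (-β)) := by
      rw [lintegral_Ioi_rpow (by linarith) one_pos, Real.one_rpow]
      congr 1
      rw [show -β + 1 = -(β - 1) by ring, neg_div_neg_eq]
    rw [ENNReal.ofReal_mul (by positivity), this, ← lintegral_const_mul' _ _ ENNReal.ofReal_ne_top]
    refine setLIntegral_mono' measurableSet_Ioi fun s hs => ?_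
    have hs0 : 0 < s := one_pos.trans hs
    refine (mul_le_mul_right ((measure_mono ((Ioo_subset_Ioo_left zero_le_one).trans
      Ioo_subset_Ioc_self)).trans (hδ s hs0)) _).trans ?_
    rw [← ENNReal.ofReal_mul (mul_nonneg hβ0.le (Real.rpow_nonneg hs0.le _)),
      ← ENNReal.ofReal_mul (by positivity)]
    refine ENNReal.ofReal_le_ofReal (le_of_eq ?_)
    rw [Real.rpow_sub_one hs0.ne']
    field_simp
  refine (add_le_add e1 e2).trans ?_
  rw [← ENNReal.ofReal_add (by positivity) (by positivity)]
  refine ENNReal.ofReal_le_ofReal (le_of_eq ?_)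
  field_simp

/-! ### Mass of the mixing measure near zero -/

section

variable {k l : ℝ → ℝ}

theorem IsPC.monotone_neg_propagation (h : IsPC k l) {t : ℝ} (ht : 0 < t) :
    Monotone fun τ => -propagation k t (max τ 0) := by
  intro a b hab
  have := h.isFiniteMeasure_subordinator (le_max_right a 0)
  simp only
  rw [h.propagation_eq (le_max_right a 0) ht, h.propagation_eq (le_max_right b 0) ht,
    neg_le_neg_iff]
  exact ENNReal.toReal_mono (measure_ne_top _ _) (h.subordinator_Iio_anti t
    (mem_Ici.2 (le_max_right _ _)) (mem_Ici.2 (le_max_right _ _)) (max_le_max hab le_rfl))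

theorem IsPC.propagation_nonneg (h : IsPC k l) {t : ℝ} (ht : 0 < t) {τ : ℝ} (hτ : 0 ≤ τ) :
    0 ≤ propagation k t τ := by
  rw [h.propagation_eq hτ ht]; exact measureReal_nonneg

theorem IsPC.propagation_le_one (h : IsPC k l) {t : ℝ} (ht : 0 < t) {τ : ℝ} (hτ : 0 ≤ τ) :
    propagation k t τ ≤ 1 := by
  rw [h.propagation_eq hτ ht]
  exact ENNReal.toReal_le_of_le_ofReal zero_le_one (by simpa using h.subordinator_le_one hτ _)

theorem IsPC.one_sub_propagation_le (h : IsPC k l) {t : ℝ} (ht : 0 < t) {δ : ℝ} (hδ : 0 ≤ δ) :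
    1 - propagation k t δ ≤ δ / (inverseMoment k t).toReal := by
  have := h.isFiniteMeasure_subordinator hδ
  have hfin := h.inverseMoment_ne_top t
  have hpos : 0 < (inverseMoment k t).toReal :=
    ENNReal.toReal_pos (h.inverseMoment_pos ht).ne' hfin
  have h1 := ENNReal.toReal_mono (by finiteness) (h.inverseMoment_le hδ t)
  rw [ENNReal.toReal_add (by finiteness) (by finiteness), ENNReal.toReal_ofReal hδ,
    ENNReal.toReal_mul] at h1
  rw [h.propagation_eq hδ ht, le_div_iff₀ hpos, measureReal_def]
  linarith

theorem IsPC.mixingMeasure_eq (h : IsPC k l) {t : ℝ} (ht : 0 < t) :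
    mixingMeasure k t = (h.monotone_neg_propagation ht).stieltjesFunction.measure := by
  rw [mixingMeasure, stieltjesMeasure, dif_pos]

theorem IsPC.sfinite_mixingMeasure (h : IsPC k l) {t : ℝ} (ht : 0 < t) :
    SFinite (mixingMeasure k t) := by
  rw [h.mixingMeasure_eq ht]; infer_instance

/-- The Stieltjes construction takes right limits in $\tau$. Evaluating at some $\varepsilon>\delta$
avoids having to prove right-continuity of $w(t,\cdot)$; afterwards $\varepsilon\downarrow\delta$ in
the explicit bound. -/
theorem IsPC.mixingMeasure_Ioc_le_one_sub (h : IsPC k l) {t : ℝ} (ht : 0 < t) {δ ε : ℝ}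
    (hδ : 0 < δ) (hε : δ < ε) :
    mixingMeasure k t (Ioc 0 δ) ≤ ENNReal.ofReal (1 - propagation k t ε) := by
  have hmono := h.monotone_neg_propagation ht
  rw [h.mixingMeasure_eq ht, StieltjesFunction.measure_Ioc]
  refine ENNReal.ofReal_le_ofReal ?_
  rw [Monotone.stieltjesFunction_eq, Monotone.stieltjesFunction_eq]
  have h1 := hmono.rightLim_le hε
  have h2 := hmono.le_rightLim (le_refl (0 : ℝ))
  simp only [max_self, max_eq_left (hδ.trans hε).le] at h1 h2
  have h3 := h.propagation_le_one ht (le_refl 0)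
  linarith

theorem IsPC.mixingMeasure_Ioc_le_one (h : IsPC k l) {t : ℝ} (ht : 0 < t) {δ : ℝ} (hδ : 0 < δ) :
    mixingMeasure k t (Ioc 0 δ) ≤ 1 := by
  refine (h.mixingMeasure_Ioc_le_one_sub ht hδ (lt_add_one δ)).trans ?_
  rw [ENNReal.ofReal_le_one]
  linarith [h.propagation_nonneg ht (add_nonneg hδ.le zero_le_one)]

theorem IsPC.mixingMeasure_Ioc_le (h : IsPC k l) {t : ℝ} (ht : 0 < t) {δ : ℝ} (hδ : 0 < δ) :
    mixingMeasure k t (Ioc 0 δ) ≤ ENNReal.ofReal (δ / timeConv (fun _ => 1) l t) := by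
  rw [h.timeConv_one ht]
  have hT : Tendsto (fun ε => ENNReal.ofReal (ε / (inverseMoment k t).toReal)) (𝓝[>] δ)
      (𝓝 (ENNReal.ofReal (δ / (inverseMoment k t).toReal))) :=
    (ENNReal.tendsto_ofReal ((continuous_id.div_const _).tendsto δ)).mono_left nhdsWithin_le_nhds
  refine ge_of_tendsto hT ?_
  filter_upwards [self_mem_nhdsWithin] with ε hε
  exact (h.mixingMeasure_Ioc_le_one_sub ht hδ hε).trans
    (ENNReal.ofReal_le_ofReal (h.one_sub_propagation_le ht (hδ.trans hε).le))

theorem IsPC.timeConv_one_pos (h : IsPC k l) {t : ℝ} (ht : 0 < t) :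
    0 < timeConv (fun _ => 1) l t := by
  rw [h.timeConv_one ht]
  exact ENNReal.toReal_pos (h.inverseMoment_pos ht).ne' (h.inverseMoment_ne_top t)

end

/-! ### $L_2$ estimates for heat flows and their mixtures -/

/-- Minkowski's integral inequality in `L²`. -/
theorem lintegral_sq_lintegral_le {α β : Type*} [MeasurableSpace α] [MeasurableSpace β]
    (μ : Measure α) (ν : Measure β) [SFinite μ] [SFinite ν] {F : α → β → ℝ≥0∞}
    (hF : Measurable (Function.uncurry F)) :
    (∫⁻ x, (∫⁻ a, F a x ∂μ) ^ (2 : ℝ) ∂ν) ^ (1 / 2 : ℝ) ≤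
      ∫⁻ a, (∫⁻ x, F a x ^ (2 : ℝ) ∂ν) ^ (1 / 2 : ℝ) ∂μ := by
  set N : α → ℝ≥0∞ := fun a => (∫⁻ x, F a x ^ (2 : ℝ) ∂ν) ^ (1 / 2 : ℝ) with hN
  have hF' : ∀ a, Measurable (F a) := fun a => hF.comp measurable_prodMk_left
  have hF'' : ∀ x, Measurable fun a => F a x := fun x => hF.comp measurable_prodMk_right
  have hNm : Measurable N := by
    refine Measurable.pow_const ?_ _
    exact Measurable.lintegral_prod_right' (hF.pow_const (2 : ℝ))
  -- The square is written as a double integral over $(a,b)$, so that after Tonelli Cauchy–Schwarz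
  -- in $x$ bounds each pair by `N a * N b`.
  have h1 : ∀ x, (∫⁻ a, F a x ∂μ) ^ (2 : ℝ) = ∫⁻ a, ∫⁻ b, F a x * F b x ∂μ ∂μ := by
    intro x
    rw [ENNReal.rpow_two, sq, ← lintegral_mul_const _ (hF'' x)]
    exact lintegral_congr fun a => (lintegral_const_mul _ (hF'' x)).symm
  have h3 : Measurable fun p : (β × α) × α => F p.1.2 p.1.1 * F p.2 p.1.1 :=
    (hF.comp (by fun_prop : Measurable fun p : (β × α) × α => (p.1.2, p.1.1))).mul
      (hF.comp (by fun_prop : Measurable fun p : (β × α) × α => (p.2, p.1.1)))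
  have h2 : ∫⁻ x, (∫⁻ a, F a x ∂μ) ^ (2 : ℝ) ∂ν ≤ (∫⁻ a, N a ∂μ) ^ (2 : ℝ) := by
    simp_rw [h1]
    rw [lintegral_lintegral_swap (Measurable.lintegral_prod_right' h3).aemeasurable]
    have h4 : ∀ a, ∫⁻ x, ∫⁻ b, F a x * F b x ∂μ ∂ν = ∫⁻ b, ∫⁻ x, F a x * F b x ∂ν ∂μ := fun a => by
      refine lintegral_lintegral_swap (Measurable.aemeasurable ?_)
      exact ((hF' a).comp measurable_fst).mul (hF.comp measurable_swap)
    simp_rw [h4]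
    calc ∫⁻ a, ∫⁻ b, ∫⁻ x, F a x * F b x ∂ν ∂μ ∂μ ≤ ∫⁻ a, ∫⁻ b, N a * N b ∂μ ∂μ := by
          refine lintegral_mono fun a => lintegral_mono fun b => ?_
          exact ENNReal.lintegral_mul_le_Lp_mul_Lq ν Real.HolderConjugate.two_two
            (hF' a).aemeasurable (hF' b).aemeasurable
      _ = (∫⁻ a, N a ∂μ) ^ (2 : ℝ) := by
          rw [ENNReal.rpow_two, sq, ← lintegral_mul_const _ hNm]
          exact lintegral_congr fun a => lintegral_const_mul _ hNm
  calc (∫⁻ x, (∫⁻ a, F a x ∂μ) ^ (2 : ℝ) ∂ν) ^ (1 / 2 : ℝ)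
      ≤ ((∫⁻ a, N a ∂μ) ^ (2 : ℝ)) ^ (1 / 2 : ℝ) := ENNReal.rpow_le_rpow h2 (by norm_num)
    _ = ∫⁻ a, N a ∂μ := by rw [← ENNReal.rpow_mul]; norm_num

section

variable {d : ℕ}

local notation "E" => EuclideanSpace ℝ (Fin d)

theorem measurable_heatKernel :
    Measurable fun p : ℝ × E => heatKernel p.1 p.2 := by
  unfold heatKernel
  fun_prop

theorem heatKernel_nonneg {τ : ℝ} (hτ : 0 ≤ τ) (x : E) : 0 ≤ heatKernel τ x := by
  unfold heatKernel; positivity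

theorem lintegral_gaussian {b : ℝ} (hb : 0 < b) :
    ∫⁻ x : E, ENNReal.ofReal (Real.exp (-b * ‖x‖ ^ 2)) =
      ENNReal.ofReal ((Real.pi / b) ^ ((d : ℝ) / 2)) := by
  have h := GaussianFourier.integral_rexp_neg_mul_sq_norm (V := E) hb
  rw [finrank_euclideanSpace_fin] at h
  rw [← h, ofReal_integral_eq_lintegral_ofReal _ (ae_of_all _ fun x => (Real.exp_pos _).le)]
  by_contra hc
  rw [integral_undef hc] at h
  have : 0 < (Real.pi / b) ^ ((d : ℝ) / 2) := by positivity
  exact this.ne h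

theorem lintegral_heatKernel {τ : ℝ} (hτ : 0 < τ) :
    ∫⁻ x : E, ENNReal.ofReal (heatKernel τ x) = 1 := by
  have h1 : ∀ x : E, ENNReal.ofReal (heatKernel τ x) =
      ENNReal.ofReal ((4 * Real.pi * τ) ^ (-((d : ℝ) / 2))) *
        ENNReal.ofReal (Real.exp (-(1 / (4 * τ)) * ‖x‖ ^ 2)) := fun x => by
    rw [heatKernel, ENNReal.ofReal_mul (by positivity)]
    congr 3; ring
  simp_rw [h1]
  rw [lintegral_const_mul' _ _ ENNReal.ofReal_ne_top, lintegral_gaussian (by positivity),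
    ← ENNReal.ofReal_mul (by positivity), Real.rpow_neg (by positivity),
    show Real.pi / (1 / (4 * τ)) = 4 * Real.pi * τ by field_simp,
    inv_mul_cancel₀ (by positivity), ENNReal.ofReal_one]

/-- The squared kernel is again Gaussian: $(4\pi\tau)^{-d}(2\pi\tau)^{d/2}=(8\pi\tau)^{-d/2}$. -/
theorem lintegral_sq_heatKernel {τ : ℝ} (hτ : 0 < τ) :
    (∫⁻ x : E, ENNReal.ofReal (heatKernel τ x) ^ (2 : ℝ)) ^ (1 / 2 : ℝ) =
      ENNReal.ofReal ((8 * Real.pi * τ) ^ (-((d : ℝ) / 4))) := by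
  have h1 : ∀ x : E, ENNReal.ofReal (heatKernel τ x) ^ (2 : ℝ) =
      ENNReal.ofReal (((4 * Real.pi * τ) ^ (-((d : ℝ) / 2))) ^ 2) *
        ENNReal.ofReal (Real.exp (-(1 / (2 * τ)) * ‖x‖ ^ 2)) := fun x => by
    rw [heatKernel, ENNReal.rpow_two, ← ENNReal.ofReal_pow (by positivity),
      ← ENNReal.ofReal_mul (by positivity), mul_pow, ← Real.exp_nat_mul]
    congr 3; push_cast; field_simp; ring
  simp_rw [h1]
  rw [lintegral_const_mul' _ _ ENNReal.ofReal_ne_top, lintegral_gaussian (by positivity),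
    ← ENNReal.ofReal_mul (by positivity), ENNReal.ofReal_rpow_of_nonneg (by positivity) (by norm_num)]
  congr 1
  have e1 : ((4 * Real.pi * τ) ^ (-((d : ℝ) / 2))) ^ 2 = ((4 * Real.pi * τ) ^ 2) ^ (-((d : ℝ) / 2)) :=
    Real.rpow_pow_comm (by positivity) _ _
  have e2 : (Real.pi / (1 / (2 * τ))) ^ ((d : ℝ) / 2) = ((2 * Real.pi * τ)⁻¹) ^ (-((d : ℝ) / 2)) := by
    rw [Real.inv_rpow (by positivity), Real.rpow_neg (by positivity), inv_inv]
    congr 1; field_simp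
  rw [e1, e2, ← Real.mul_rpow (by positivity) (by positivity), ← Real.rpow_mul (by positivity)]
  congr 1
  · field_simp; norm_num
  · ring

/-- Young's inequality `L² ∗ L¹ ⊆ L²`. -/
theorem lintegral_sq_conv_le {H g : E → ℝ≥0∞} (hH : Measurable H) (hg : Measurable g) :
    (∫⁻ x, (∫⁻ y, H (x - y) * g y) ^ (2 : ℝ)) ^ (1 / 2 : ℝ) ≤
      (∫⁻ x, H x ^ (2 : ℝ)) ^ (1 / 2 : ℝ) * ∫⁻ y, g y := by
  have hm : Measurable (Function.uncurry fun (y x : E) => H (x - y) * g y) :=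
    (hH.comp (by fun_prop : Measurable fun p : E × E => p.2 - p.1)).mul (hg.comp measurable_fst)
  refine (lintegral_sq_lintegral_le volume volume hm).trans (le_of_eq ?_)
  rw [← lintegral_const_mul _ hg]
  refine lintegral_congr fun y => ?_
  simp_rw [ENNReal.mul_rpow_of_nonneg _ _ (zero_le_two (α := ℝ))]
  have hH2 : Measurable fun x : E => H (x - y) ^ (2 : ℝ) :=
    (hH.comp (by fun_prop : Measurable fun x : E => x - y)).pow_const _
  rw [lintegral_mul_const _ hH2, lintegral_sub_right_eq_self (fun x => H x ^ (2 : ℝ)) y,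
    ENNReal.mul_rpow_of_nonneg _ _ (by norm_num), ← ENNReal.rpow_mul (g y)]
  norm_num

theorem lintegral_sq_conv_le' {H g : E → ℝ≥0∞} (hH : Measurable H) (hg : Measurable g) :
    (∫⁻ x, (∫⁻ y, H (x - y) * g y) ^ (2 : ℝ)) ^ (1 / 2 : ℝ) ≤
      (∫⁻ x, H x) * (∫⁻ y, g y ^ (2 : ℝ)) ^ (1 / 2 : ℝ) := by
  have h1 : ∀ x, ∫⁻ y, H (x - y) * g y = ∫⁻ y, g (x - y) * H y := fun x => by
    rw [← lintegral_sub_left_eq_self _ x]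
    simp [mul_comm]
  simp_rw [h1]
  exact (lintegral_sq_conv_le hg hH).trans (le_of_eq (mul_comm _ _))

/-- `L²` bound for a mixture of heat flows. -/
theorem lintegral_sq_mixture_le (μ : Measure ℝ) [SFinite μ] {g : E → ℝ≥0∞} (hg : Measurable g) :
    (∫⁻ x, (∫⁻ y, (∫⁻ τ in Ioi 0, ENNReal.ofReal (heatKernel τ (x - y)) ∂μ) * g y) ^ (2 : ℝ))
        ^ (1 / 2 : ℝ) ≤
      ∫⁻ τ in Ioi 0, min ((∫⁻ y, g y ^ (2 : ℝ)) ^ (1 / 2 : ℝ))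
        (ENNReal.ofReal ((8 * Real.pi * τ) ^ (-((d : ℝ) / 4))) * ∫⁻ y, g y) ∂μ := by
  have hk : Measurable fun p : ℝ × E => ENNReal.ofReal (heatKernel p.1 p.2) :=
    measurable_heatKernel.ennreal_ofReal
  have hk' : ∀ τ, Measurable fun x : E => ENNReal.ofReal (heatKernel τ x) :=
    fun τ => hk.comp measurable_prodMk_left
  have h1 : ∀ x : E, ∫⁻ y, (∫⁻ τ in Ioi 0, ENNReal.ofReal (heatKernel τ (x - y)) ∂μ) * g y =
      ∫⁻ τ in Ioi 0, (∫⁻ y, ENNReal.ofReal (heatKernel τ (x - y)) * g y) ∂μ := by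
    intro x
    rw [← lintegral_lintegral_swap]
    · refine lintegral_congr fun y => (lintegral_mul_const _ ?_).symm
      exact hk.comp (by fun_prop : Measurable fun τ : ℝ => (τ, x - y))
    · exact ((hk.comp (by fun_prop : Measurable fun p : E × ℝ => (p.2, x - p.1))).mul
        (hg.comp measurable_fst)).aemeasurable
  simp_rw [h1]
  have hm : Measurable (Function.uncurry fun (τ : ℝ) (x : E) =>
      ∫⁻ y, ENNReal.ofReal (heatKernel τ (x - y)) * g y) := by
    have : Measurable fun p : (ℝ × E) × E =>
        ENNReal.ofReal (heatKernel p.1.1 (p.1.2 - p.2)) * g p.2 :=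
      (hk.comp (by fun_prop : Measurable fun p : (ℝ × E) × E => (p.1.1, p.1.2 - p.2))).mul
        (hg.comp measurable_snd)
    exact this.lintegral_prod_right'
  refine (lintegral_sq_lintegral_le (μ.restrict (Ioi 0)) volume hm).trans ?_
  refine setLIntegral_mono' measurableSet_Ioi fun τ hτ => le_min ?_ ?_
  · refine (lintegral_sq_conv_le' (hk' τ) hg).trans ?_
    rw [lintegral_heatKernel hτ, one_mul]
  · refine (lintegral_sq_conv_le (hk' τ) hg).trans ?_
    rw [lintegral_sq_heatKernel hτ]

end

/-! ### The solution and its decay -/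

section

variable {d : ℕ} {𝕜 : Type*} [RCLike 𝕜] {k l : ℝ → ℝ}

theorem IsPC.measurable_fundSol (h : IsPC k l) {t : ℝ} (ht : 0 < t) :
    Measurable (fundSol k t : EuclideanSpace ℝ (Fin d) → ℝ) := by
  have := h.sfinite_mixingMeasure ht
  have hm : StronglyMeasurable fun p : EuclideanSpace ℝ (Fin d) × ℝ => heatKernel p.2 p.1 :=
    (measurable_heatKernel.comp measurable_swap).stronglyMeasurable
  exact (hm.integral_prod_right' (ν := (mixingMeasure k t).restrict (Ioi 0))).measurable

theorem enorm_fundSol_le (k : ℝ → ℝ) (t : ℝ) (x : EuclideanSpace ℝ (Fin d)) :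
    ‖fundSol k t x‖ₑ ≤
      ∫⁻ τ in Ioi 0, ENNReal.ofReal (heatKernel τ x) ∂(mixingMeasure k t) := by
  refine (enorm_integral_le_lintegral_enorm _).trans ?_
  refine setLIntegral_mono' measurableSet_Ioi fun τ hτ => ?_
  rw [Real.enorm_of_nonneg (heatKernel_nonneg (mem_Ioi.1 hτ).le x)]

theorem IsPC.aestronglyMeasurable_solution (h : IsPC k l) {t : ℝ} (ht : 0 < t)
    {u₀ : EuclideanSpace ℝ (Fin d) → 𝕜} (hu : AEStronglyMeasurable u₀) :
    AEStronglyMeasurable (solution k u₀ t) := by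
  have he : solution k u₀ t = solution k (hu.mk u₀) t := by
    ext x
    exact integral_congr_ae (hu.ae_eq_mk.mono fun y hy => by simp only [hy])
  rw [he]
  have hm : StronglyMeasurable fun p : EuclideanSpace ℝ (Fin d) × EuclideanSpace ℝ (Fin d) =>
      fundSol k t (p.1 - p.2) • hu.mk u₀ p.2 :=
    ((h.measurable_fundSol ht).comp (measurable_fst.sub measurable_snd)).stronglyMeasurable.smul
      (hu.stronglyMeasurable_mk.comp_measurable measurable_snd)
  exact hm.integral_prod_right'.aestronglyMeasurable

/-- Absolute convergence and `L²` bound of the solution in terms of the mixing measure. -/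
theorem IsPC.solution_bound (h : IsPC k l) {t : ℝ} (ht : 0 < t)
    {u₀ : EuclideanSpace ℝ (Fin d) → 𝕜} (hu : AEStronglyMeasurable u₀) {B : ℝ≥0∞} (hB : B ≠ ∞)
    (hle : ∫⁻ τ in Ioi 0, min (eLpNorm u₀ 2)
      (ENNReal.ofReal ((8 * Real.pi * τ) ^ (-((d : ℝ) / 4))) * eLpNorm u₀ 1)
        ∂(mixingMeasure k t) ≤ B) :
    (∀ᵐ x, Integrable fun y => fundSol k t (x - y) • u₀ y) ∧
      eLpNorm (solution k u₀ t) 2 ≤ B := by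
  have := h.sfinite_mixingMeasure ht
  obtain ⟨g, hg, hgu⟩ : AEMeasurable fun y => ‖u₀ y‖ₑ := hu.enorm
  have e1 : eLpNorm u₀ 1 = ∫⁻ y, g y := by
    rw [eLpNorm_one_eq_lintegral_enorm]; exact lintegral_congr_ae hgu
  have e2 : eLpNorm u₀ 2 = (∫⁻ y, g y ^ (2 : ℝ)) ^ (1 / 2 : ℝ) := by
    rw [eLpNorm_eq_lintegral_rpow_enorm_toReal two_ne_zero ENNReal.ofNat_ne_top]
    simp only [ENNReal.toReal_ofNat]
    congr 1
    exact lintegral_congr_ae (hgu.mono fun y hy => by simp only [hy])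
  rw [e1, e2] at hle
  -- A single nonnegative majorant serves both claims: its $L_2$ norm is at most `B`, so it is
  -- finite almost everywhere, which gives absolute convergence, and it dominates the solution
  -- pointwise.
  set V : EuclideanSpace ℝ (Fin d) → ℝ≥0∞ := fun x =>
    ∫⁻ y, (∫⁻ τ in Ioi 0, ENNReal.ofReal (heatKernel τ (x - y)) ∂(mixingMeasure k t)) * g y with hV
  have hVB : (∫⁻ x, V x ^ (2 : ℝ)) ^ (1 / 2 : ℝ) ≤ B :=
    (lintegral_sq_mixture_le (mixingMeasure k t) hg).trans hle
  have hVm : Measurable V := by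
    have hk : Measurable fun p : EuclideanSpace ℝ (Fin d) × ℝ =>
        ENNReal.ofReal (heatKernel p.2 p.1) :=
      (measurable_heatKernel.comp measurable_swap).ennreal_ofReal
    have h1 : Measurable fun x : EuclideanSpace ℝ (Fin d) =>
        ∫⁻ τ in Ioi 0, ENNReal.ofReal (heatKernel τ x) ∂(mixingMeasure k t) :=
      hk.lintegral_prod_right'
    have h2 : Measurable fun p : EuclideanSpace ℝ (Fin d) × EuclideanSpace ℝ (Fin d) =>
        (∫⁻ τ in Ioi 0, ENNReal.ofReal (heatKernel τ (p.1 - p.2)) ∂(mixingMeasure k t)) * g p.2 :=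
      (h1.comp (measurable_fst.sub measurable_snd)).mul (hg.comp measurable_snd)
    exact h2.lintegral_prod_right'
  have hpt : ∀ x, ∫⁻ y, ‖fundSol k t (x - y) • u₀ y‖ₑ ≤ V x := by
    intro x
    refine lintegral_mono_ae (hgu.mono fun y hy => ?_)
    rw [enorm_smul]
    exact mul_le_mul' (enorm_fundSol_le k t (x - y)) hy.le
  constructor
  · have hfin : ∫⁻ x, V x ^ (2 : ℝ) ≠ ∞ := by
      intro htop
      rw [htop, ENNReal.top_rpow_of_pos (by norm_num)] at hVB
      exact hB (top_le_iff.1 hVB)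
    filter_upwards [ae_lt_top (hVm.pow_const _) hfin] with x hx
    refine ⟨?_, (hpt x).trans_lt ?_⟩
    · exact ((h.measurable_fundSol ht).comp
        (measurable_const.sub measurable_id)).aestronglyMeasurable.smul hu
    · by_contra hc
      rw [not_lt_top_iff] at hc
      rw [hc, ENNReal.top_rpow_of_pos (by norm_num)] at hx
      exact lt_irrefl _ hx
  · refine le_trans ?_ hVB
    rw [eLpNorm_eq_lintegral_rpow_enorm_toReal two_ne_zero ENNReal.ofNat_ne_top]
    simp only [ENNReal.toReal_ofNat]
    gcongr with x
    exact (enorm_integral_le_lintegral_enorm _).trans (hpt x)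

/-- Integral of the heat-flow bound against the mixing measure. -/
theorem IsPC.exists_mixture_bound (h : IsPC k l) (hd : 1 ≤ d) (hd4 : d ≠ 4) {A B : ℝ≥0∞}
    (hA : A ≠ ∞) (hB : B ≠ ∞) :
    ∃ C : ℝ, 0 < C ∧ ∀ t : ℝ, 0 < t →
      ∫⁻ τ in Ioi 0, min A (ENNReal.ofReal ((8 * Real.pi * τ) ^ (-((d : ℝ) / 4))) * B)
        ∂(mixingMeasure k t) ≤
      ENNReal.ofReal (C * (timeConv (fun _ => 1) l t) ^ (-(min (1 : ℝ) ((d : ℝ) / 4)))) := by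
  have hd0 : (0 : ℝ) < d := by exact_mod_cast hd
  set α : ℝ := (d : ℝ) / 4 with hα
  have hα0 : 0 < α := by positivity
  set c : ℝ := (8 * Real.pi) ^ (-α) with hc
  have hc0 : 0 < c := by positivity
  have hsplit : ∀ τ ∈ Ioi (0 : ℝ), ENNReal.ofReal ((8 * Real.pi * τ) ^ (-α)) * B =
      ENNReal.ofReal (c * B.toReal) * ENNReal.ofReal (τ ^ (-α)) := by
    intro τ hτ
    rw [Real.mul_rpow (by positivity) (mem_Ioi.1 hτ).le, ENNReal.ofReal_mul hc0.le,
      ENNReal.ofReal_mul hc0.le, ENNReal.ofReal_toReal hB]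
    ring
  rcases lt_or_gt_of_ne hd4 with hlt | hgt
  · have hα1 : α < 1 := by
      have : (d : ℝ) < 4 := by exact_mod_cast hlt
      rw [hα]; linarith
    have hα' : 0 < 1 - α := by linarith
    -- The added $1$ keeps the constant positive when `B` is zero.
    refine ⟨c * B.toReal * (1 / (1 - α)) + 1, by positivity, fun t ht => ?_⟩
    have := h.sfinite_mixingMeasure ht
    have hm := h.timeConv_one_pos ht
    rw [min_eq_right hα1.le]
    calc _ ≤ ∫⁻ τ in Ioi 0, ENNReal.ofReal (c * B.toReal) * ENNReal.ofReal (τ ^ (-α))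
          ∂(mixingMeasure k t) :=
          setLIntegral_mono' measurableSet_Ioi fun τ hτ =>
            (min_le_right _ _).trans (hsplit τ hτ).le
      _ = ENNReal.ofReal (c * B.toReal) * ∫⁻ τ in Ioi 0, ENNReal.ofReal (τ ^ (-α))
          ∂(mixingMeasure k t) := lintegral_const_mul' _ _ ENNReal.ofReal_ne_top
      _ ≤ ENNReal.ofReal (c * B.toReal) *
          ENNReal.ofReal (1 / (1 - α) * (timeConv (fun _ => 1) l t) ^ (-α)) := by
          gcongr
          exact lintegral_rpow_neg_le hm (fun δ hδ => h.mixingMeasure_Ioc_le_one ht hδ)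
            (fun δ hδ => h.mixingMeasure_Ioc_le ht hδ) hα0 hα1
      _ ≤ _ := by
          rw [← ENNReal.ofReal_mul (by positivity), ← mul_assoc]
          gcongr
          linarith
  · have hα1 : 1 < α := by
      have : (4 : ℝ) < d := by exact_mod_cast hgt
      rw [hα]; linarith
    have hα' : 0 < α - 1 := by linarith
    -- `D` dominates both `A` and the coefficient of $\tau^{-\alpha}$, so it factors out of the
    -- minimum.
    set D : ℝ := A.toReal + c * B.toReal with hD
    have hD0 : 0 ≤ D := by positivity
    refine ⟨D * (1 + α / (α - 1)) + 1, by positivity, fun t ht => ?_⟩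
    have := h.sfinite_mixingMeasure ht
    have hm := h.timeConv_one_pos ht
    rw [min_eq_left hα1.le, Real.rpow_neg_one]
    calc _ ≤ ∫⁻ τ in Ioi 0, ENNReal.ofReal D * min 1 (ENNReal.ofReal (τ ^ (-α)))
          ∂(mixingMeasure k t) := by
          refine setLIntegral_mono' measurableSet_Ioi fun τ hτ => ?_
          rw [hsplit τ hτ, mul_min, mul_one]
          refine min_le_min ?_ ?_
          · rw [← ENNReal.ofReal_toReal hA]
            exact ENNReal.ofReal_le_ofReal (le_add_of_nonneg_right (by positivity))
          · gcongr
            exact le_add_of_nonneg_left ENNReal.toReal_nonneg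
      _ = ENNReal.ofReal D * ∫⁻ τ in Ioi 0, min 1 (ENNReal.ofReal (τ ^ (-α)))
          ∂(mixingMeasure k t) := lintegral_const_mul' _ _ ENNReal.ofReal_ne_top
      _ ≤ ENNReal.ofReal D *
          ENNReal.ofReal ((1 + α / (α - 1)) / timeConv (fun _ => 1) l t) := by
          gcongr
          exact lintegral_min_rpow_neg_le hm (fun δ hδ => h.mixingMeasure_Ioc_le ht hδ) hα1
      _ ≤ _ := by
          rw [← ENNReal.ofReal_mul hD0, div_eq_mul_inv, ← mul_assoc]
          gcongr
          linarith

end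

end Subdiffusion

theorem theorem4p2 {𝕜 : Type*} [RCLike 𝕜] (d : ℕ) (hd : 1 ≤ d) (hd4 : d ≠ 4)
    (k l : ℝ → ℝ) (hkl : Subdiffusion.IsPC k l)
    (u₀ : EuclideanSpace ℝ (Fin d) → 𝕜)
    (hu1 : MeasureTheory.MemLp u₀ 1) (hu2 : MeasureTheory.MemLp u₀ 2) :
    (∀ t : ℝ, 0 < t →
      (∀ᵐ x : EuclideanSpace ℝ (Fin d),
        MeasureTheory.Integrable (fun y => Subdiffusion.fundSol k t (x - y) • u₀ y)) ∧
      MeasureTheory.MemLp (Subdiffusion.solution k u₀ t) 2) ∧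
    (∀ t : ℝ, 0 < t → 0 < Subdiffusion.timeConv (fun _ => 1) l t) ∧
    ∃ C : ℝ, 0 < C ∧ ∀ t : ℝ, 0 < t →
      MeasureTheory.eLpNorm (Subdiffusion.solution k u₀ t) 2 MeasureTheory.volume ≤
        ENNReal.ofReal
          (C * (Subdiffusion.timeConv (fun _ => 1) l t) ^ (-(min (1 : ℝ) ((d : ℝ) / 4)))) := by
  obtain ⟨C, hC, hbound⟩ := hkl.exists_mixture_bound hd hd4 hu2.eLpNorm_ne_top hu1.eLpNorm_ne_top
  have main := fun (t : ℝ) (ht : 0 < t) =>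
    hkl.solution_bound ht hu1.aestronglyMeasurable ENNReal.ofReal_ne_top (hbound t ht)
  exact ⟨fun t ht => ⟨(main t ht).1, hkl.aestronglyMeasurable_solution ht hu1.aestronglyMeasurable,
    (main t ht).2.trans_lt ENNReal.ofReal_lt_top⟩, fun t ht => hkl.timeConv_one_pos ht,
    C, hC, fun t ht => (main t ht).2⟩
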